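/- **Setting.** Let $G\subset\mathbb{C}$ be a nonempty connected open set and let $f$ be meromorphic on an open set $U\supset\mathrm{cl}(G)$, with $|f|$ taking the value $\infty$ at poles. For $\epsilon\in[0,\infty]$ put $E_{f,\epsilon}=\{z\in U:|f(z)|=\epsilon\}$; the connected components of the sets $E_{f,\epsilon}$ are the *level curves* of $f$, a level curve *in $G$* is one contained in $G$, and $\Lambda_z$ denotes the level curve containing $z$. A level curve is *critical* if it is not a single zero or pole of $f$ and contains a zero of $f'$; otherwise it is *non-critical*. The *faces* of a set are the connected components of its complement in $\mathbb{C}$. Let $\mathrm{sc}(G)$ be the union of $G$ with all bounded components of $G^c$. Assume: * $|f|\equiv 1$ on each unbounded component of $\partial G$, and on each bounded component of $\partial G$, $|f|$ is constant with value in $(0,\infty)$; * if $G$ is unbounded, then $\lim_{z\in G,\,z\to\infty}|f(z)|=1$; * $G$ contains no unbounded level curve of $f$; * $G^c$ has only finitely many bounded components; * $\mathrm{cl}(\Lambda_z)\subset G$ for every $z\in G$. **Proposition.** Let $L$ be a level curve of $f$ in $G$ or a component of $\partial G$, and let $\eta\in[0,\infty]$ be the constant value of $|f|$ on $L$. Let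 $K\subset\mathrm{sc}(G)$ be a closed subset of $\mathbb{C}$ contained in a single component $C$ of $L^c$, and suppose that at least one of $L$, $K$ is bounded. Then there is $\delta>0$ such that for every $z\in G\cap C$ with $\mathrm{dist}(z,L)<\delta$: 1. $|f(z)|\neq\eta$; 2. $\Lambda_z$ is a non-critical level curve of $f$ in $G$; 3. $K$ and $L$ are contained in different faces of $\Lambda_z$; 4. if $L$ is bounded and $C$ is the unbounded face of $L$, then $K$ is contained in the unbounded face of $\Lambda_z$; otherwise $\Lambda_z$ has exactly one bounded face and $K$ is contained in it. -/

import Mathlib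

open Set Filter Topology
open scoped ENNReal

/-- `C` is a connected component of the set `S`. -/
def IsComponentOf (S C : Set ℂ) : Prop :=
  ∃ x ∈ S, C = connectedComponentIn S x

/-- A face of `Λ` is a connected component of its complement. -/
def IsFace (Λ F : Set ℂ) : Prop :=
  IsComponentOf Λᶜ F

/-- The modulus `|f z| ∈ [0, ∞]` of a meromorphic function in normal form: it is `∞` at the poles
(where a function in normal form takes a conventional finite value), and `‖f z‖` elsewhere. -/
noncomputable def extMod (f : ℂ → ℂ) (z : ℂ) : ℝ≥0∞ :=
  open Classical in if meromorphicOrderAt f z < 0 then ⊤ else ‖f z‖ₑ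

/-- The level set `E_{f,ε} = {z ∈ U : |f z| = ε}` of a function `f` with domain `U`. -/
def levelSet (f : ℂ → ℂ) (U : Set ℂ) (ε : ℝ≥0∞) : Set ℂ :=
  {z ∈ U | extMod f z = ε}

/-- `Λ_z`: the connected component containing `z` of the level set `E_{f,|f z|}`. -/
noncomputable def levelCurve (f : ℂ → ℂ) (U : Set ℂ) (z : ℂ) : Set ℂ :=
  connectedComponentIn (levelSet f U (extMod f z)) z

/-- `L` is a level curve of `f` (a component of some level set) which is contained in `G`. -/
def IsLevelCurveIn (f : ℂ → ℂ) (U G L : Set ℂ) : Prop :=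
  (∃ ε : ℝ≥0∞, IsComponentOf (levelSet f U ε) L) ∧ L ⊆ G

/-- `z` is a critical point of `f`, i.e. a zero of `f'`
(poles are excluded by requiring analyticity). -/
def IsCriticalPt (f : ℂ → ℂ) (z : ℂ) : Prop :=
  AnalyticAt ℂ f z ∧ deriv f z = 0

/-- A level curve is critical if it is not a zero or a pole of `f` and
contains a critical point of `f`. -/
def IsCriticalCurve (f : ℂ → ℂ) (L : Set ℂ) : Prop :=
  (¬ ∃ z, L = {z} ∧ (extMod f z = 0 ∨ extMod f z = ⊤)) ∧ ∃ z ∈ L, IsCriticalPt f z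

/-- `sc D`: the union of `D` with the bounded components of its complement. -/
def sc (D : Set ℂ) : Set ℂ :=
  D ∪ ⋃₀ {C | IsComponentOf Dᶜ C ∧ Bornology.IsBounded C}

/-- The standing assumptions on a region `G` and a function `f`, meromorphic on an open set `U`
containing the closure of `G`. Meromorphic functions are represented by their normal forms:
they are analytic away from their poles. -/
structure LevelCurveSetting (f : ℂ → ℂ) (U G : Set ℂ) : Prop where
  isOpen_dom : IsOpen U
  meromorphic : MeromorphicNFOn f U
  isOpen : IsOpen G
  connected : IsConnected G
  closure_subset : closure G ⊆ U
  /-- `|f| = 1` on every unbounded component of the boundary. -/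
  unbounded_boundary : ∀ C, IsComponentOf (frontier G) C → ¬ Bornology.IsBounded C →
    ∀ z ∈ C, extMod f z = 1
  /-- `|f|` is constant, with value in `(0, ∞)`, on every bounded component of the boundary. -/
  bounded_boundary : ∀ C, IsComponentOf (frontier G) C → Bornology.IsBounded C →
    ∃ ρ : ℝ≥0∞, 0 < ρ ∧ ρ < ⊤ ∧ ∀ z ∈ C, extMod f z = ρ
  /-- If `G` is unbounded then `|f z| → 1` as `z → ∞` in `G`. -/
  tendsto_infinity : ¬ Bornology.IsBounded G →
    Tendsto (extMod f) (Bornology.cobounded ℂ ⊓ 𝓟 G) (𝓝 1)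
  /-- `G` contains no unbounded level curve. -/
  bounded_curves : ∀ L, IsLevelCurveIn f U G L → Bornology.IsBounded L
  /-- The complement of `G` has finitely many bounded components. -/
  finite_holes : {C | IsComponentOf Gᶜ C ∧ Bornology.IsBounded C}.Finite
  /-- No level curve of a point of `G` meets the boundary of `G`. -/
  closure_curve_subset : ∀ z ∈ G, closure (levelCurve f U z) ⊆ G

/-! The argument is by contradiction along a sequence of bad points `z n` of `G ∩ C` whose distance
to `L` tends to `0`. Call the bounded components of `Gᶜ` and the zeros and poles in `G` obstacles.
There are finitely many: holes by hypothesis, zeros and poles because `|f| → 1` at infinity and they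
cannot accumulate in `closure G`. By the pigeonhole principle, infinitely many of the curves `Λ_{z
n}` surround the same obstacles.

A level curve through a regular point has a bounded face (`enclosed_nonempty`), and by the maximum
and minimum principles every bounded face contains an obstacle. Hence distinct curves surrounding
the same obstacles surround a common point, so they are nested. The ring between them is free of
obstacles, and `|f|` lies there strictly between its values on the two curves (`extMod_mem_Ioo`).
Three consequences follow. Curves with the same obstacles and the same modulus coincide, so `|f (z
n)| = η` cannot recur infinitely often. The outer curve of a nested pair has only one bounded face.
A curve nested between two others has larger modulus on one side and smaller on the other, both
sides being connected. At a critical point the modulus would alternate along four rays, and a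
winding number argument excludes this (`not_alternating_rays`).

By Ramsey's theorem a subsequence of the curves is monotone for nesting. If the curves increase,
their filled interiors exhaust a bounded face of `L`, or all of `sc G` when `L` is unbounded. If
they decrease, their outer faces exhaust the unbounded face of `L`. In either case some curve
separates `K` from `L`, so its point was not bad. Exhaustion rests on the fact that the curves
converge to a bounded `L`, since a compact component of a level set has isolating neighbourhoods
(`exists_isolating_nhds`). -/

/-! ### Continuous logarithms and plane topology -/

/-- Two continuous logarithms of the same function on a preconnected set differ by a constant. -/
theorem IsPreconnected.sub_eq_of_exp_eq {X : Type*} [TopologicalSpace X] {s : Set X}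
    (hs : IsPreconnected s) {g h : X → ℂ} (hg : ContinuousOn g s) (hh : ContinuousOn h s)
    {c : ℂ} (he : ∀ x ∈ s, Complex.exp (g x) = c * Complex.exp (h x))
    {x y : X} (hx : x ∈ s) (hy : y ∈ s) : g x - h x = g y - h y := by
  refine hs.induction₂ (fun x y => g x - h x = g y - h y) ?_ ?_ ?_ hx hy
  · intro x hx
    have hcont : ContinuousWithinAt (fun y => g y - h y) s x := (hg x hx).sub (hh x hx)
    have := Metric.tendsto_nhds.1 hcont 1 one_pos
    filter_upwards [this, self_mem_nhdsWithin] with y hy hys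
    have e1 : Complex.exp (g y - h y) = Complex.exp (g x - h x) := by
      rw [Complex.exp_sub, Complex.exp_sub, he y hys, he x hx,
        mul_div_cancel_right₀ _ (Complex.exp_ne_zero _),
        mul_div_cancel_right₀ _ (Complex.exp_ne_zero _)]
    obtain ⟨n, hn⟩ := Complex.exp_eq_exp_iff_exists_int.1 e1
    rw [hn, dist_eq_norm, add_sub_cancel_left, norm_mul, norm_mul, norm_mul] at hy
    -- The difference is `2πin` with norm below `1`, while `2π > 1`.
    have hn0 : n = 0 := by
      by_contra h0
      have : (1 : ℝ) ≤ |(n : ℝ)| := by exact_mod_cast Int.one_le_abs h0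
      have hpi := Real.pi_gt_three
      simp only [Complex.norm_intCast, Complex.norm_ofNat, Complex.norm_real, Complex.norm_I,
        Real.norm_eq_abs, abs_of_pos Real.pi_pos, mul_one] at hy
      nlinarith
    simp [hn, hn0]
  · intro x y z _ _ _ h1 h2; exact h1.trans h2
  · intro x y _ _ h; exact h.symm

/-- A nowhere vanishing continuous function on the plane has a continuous logarithm. -/
theorem exists_continuous_log {F : ℂ → ℂ} (hF : Continuous F) (h0 : ∀ z, F z ≠ 0) :
    ∃ Θ : ℂ → ℂ, Continuous Θ ∧ ∀ z, Complex.exp (Θ z) = F z := by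
  have hsc : IsSimplyConnected (univ : Set ℂ) := by
    have := (convex_univ (𝕜 := ℝ) (E := ℂ)).contractibleSpace univ_nonempty
    change SimplyConnectedSpace _
    infer_instance
  obtain ⟨Θ, h1, h2⟩ := Complex.exists_continuousOn_eqOn_exp_comp hsc isOpen_univ
    hF.continuousOn (by rintro ⟨z, _, hz⟩; exact h0 z hz)
  exact ⟨Θ, continuousOn_univ.1 h1, fun z => h2 (mem_univ z)⟩

/-- Unicoherence of the plane: if two connected open sets cover the plane, then their
intersection is connected. -/
theorem isPreconnected_inter_of_union_eq_univ {A B : Set ℂ} (hA : IsOpen A) (hB : IsOpen B)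
    (hAc : IsPreconnected A) (hBc : IsPreconnected B) (hAB : A ∪ B = univ) :
    IsPreconnected (A ∩ B) := by
  classical
  intro u v hu hv huv ⟨p, hp, hpu⟩ ⟨q, hq, hqv⟩
  by_contra hne
  rw [not_nonempty_iff_eq_empty] at hne
  set Q : Set ℂ := A ∩ B ∩ v with hQ
  have hdisj : Disjoint (Bᶜ) (Aᶜ) := by
    rw [Set.disjoint_left]
    intro x hx hx'
    have : x ∈ A ∪ B := by rw [hAB]; trivial
    exact this.elim hx' hx
  obtain ⟨χ, hχ0, hχ1, -⟩ := exists_continuous_zero_one_of_isClosed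
    hB.isClosed_compl hA.isClosed_compl hdisj
  have hfr : ∀ x ∈ frontier Q, x ∈ Bᶜ ∨ x ∈ Aᶜ := by
    intro x hx
    by_contra hcon
    simp only [mem_compl_iff, not_or, not_not] at hcon
    have hxAB : x ∈ A ∩ B := ⟨hcon.2, hcon.1⟩
    have hQo : IsOpen Q := (hA.inter hB).inter hv
    rw [hQo.frontier_eq] at hx
    rcases huv hxAB with h | h
    · obtain ⟨y, hy1, hy2⟩ := mem_closure_iff.1 hx.1 _ hu h
      have : y ∈ A ∩ B ∩ (u ∩ v) := ⟨hy2.1, hy1, hy2.2⟩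
      rw [hne] at this; exact this
    · exact hx.2 ⟨hxAB, h⟩
  set w : ℂ → ℂ := fun z => 2 * Real.pi * Complex.I * ((χ z : ℝ) : ℂ) with hw
  have hwc : Continuous w := by fun_prop
  have hw0 : ∀ z ∈ Bᶜ, w z = 0 := by intro z hz; simp [hw, hχ0 hz]
  have hw1 : ∀ z ∈ Aᶜ, w z = 2 * Real.pi * Complex.I := by intro z hz; simp [hw, hχ1 hz]
  -- `F` winds once while crossing `Q` from `Bᶜ` to `Aᶜ` and is `1` elsewhere. It is continuous
  -- because `exp w = 1` on the frontier of `Q`. Its logarithm can be written explicitly on `A` and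
  -- on `B`, and the two versions disagree by `2πi` about the change from `p` to `q`.
  set F : ℂ → ℂ := fun z => if z ∈ Q then Complex.exp (w z) else 1 with hF
  have hFc : Continuous F := by
    refine Continuous.if (p := fun z => z ∈ Q) ?_ (by fun_prop) continuous_const
    intro a ha
    rcases hfr a ha with h | h
    · simp [hw0 a h]
    · simp [hw1 a h, Complex.exp_two_pi_mul_I]
  obtain ⟨Θ, hΘ, hΘF⟩ := exists_continuous_log hFc (by
    intro z; simp only [hF]; split_ifs
    · exact Complex.exp_ne_zero _
    · exact one_ne_zero)
  set θ₁ : ℂ → ℂ := fun z => if z ∈ Q then w z else 0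
  set θ₂ : ℂ → ℂ := fun z => if z ∈ Q then w z - 2 * Real.pi * Complex.I else 0
  have h1c : ContinuousOn θ₁ A := by
    refine ContinuousOn.if (p := fun z => z ∈ Q) ?_ hwc.continuousOn continuousOn_const
    rintro a ⟨haA, ha⟩
    rcases hfr a ha with h | h
    · exact hw0 a h
    · exact absurd haA h
  have h2c : ContinuousOn θ₂ B := by
    refine ContinuousOn.if (p := fun z => z ∈ Q) ?_ (by fun_prop) continuousOn_const
    rintro a ⟨haB, ha⟩
    rcases hfr a ha with h | h
    · exact absurd haB h
    · simp [hw1 a h]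
  have hpQ : p ∉ Q := fun h => by
    have : p ∈ A ∩ B ∩ (u ∩ v) := ⟨hp, hpu, h.2⟩
    rw [hne] at this; exact this
  have hqQ : q ∈ Q := ⟨hq, hqv⟩
  have e1 := hAc.sub_eq_of_exp_eq hΘ.continuousOn h1c (c := 1) (by
    intro x _
    simp only [hΘF, hF, θ₁]
    split_ifs <;> simp) hp.1 hq.1
  have e2 := hBc.sub_eq_of_exp_eq hΘ.continuousOn h2c (c := 1) (by
    intro x _
    simp only [hΘF, hF, θ₂]
    split_ifs
    · simp [Complex.exp_sub, Complex.exp_two_pi_mul_I]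
    · simp) hp.2 hq.2
  simp only [θ₁, θ₂, if_neg hpQ, if_pos hqQ] at e1 e2
  have : (2 * Real.pi * Complex.I : ℂ) = 0 := by linear_combination e1 - e2
  exact Complex.two_pi_I_ne_zero this

/-- Points of a connected set in the complement of a compact set `T` are not separated by the
logarithm on `T`. -/
theorem exists_continuousOn_log_sub_div_sub {T W : Set ℂ} (hT : IsCompact T)
    (hW : IsPreconnected W) (hWT : Disjoint W T) {p q : ℂ} (hp : p ∈ W) (hq : q ∈ W) :
    ∃ g : ℂ → ℂ, ContinuousOn g T ∧ ∀ z ∈ T, Complex.exp (g z) = (z - p) / (z - q) := by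
  have hne : ∀ {x z}, x ∈ W → z ∈ T → z - x ≠ 0 := by
    intro x z hx hz h
    rw [sub_eq_zero] at h
    exact Set.disjoint_left.1 hWT hx (h ▸ hz)
  refine hW.induction₂ (fun p q => ∃ g : ℂ → ℂ, ContinuousOn g T ∧
    ∀ z ∈ T, Complex.exp (g z) = (z - p) / (z - q)) ?_ ?_ ?_ hp hq
  · intro x hx
    have hxT : x ∈ Tᶜ := Set.disjoint_left.1 hWT hx
    obtain ⟨ε, hε, hball⟩ := Metric.isOpen_iff.1 hT.isClosed.isOpen_compl x hxT
    have : Metric.ball x (ε / 2) ∈ 𝓝[W] x :=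
      mem_nhdsWithin_of_mem_nhds (Metric.ball_mem_nhds x (half_pos hε))
    filter_upwards [this, self_mem_nhdsWithin] with y hy hyW
    -- For `y` much closer to `x` than `T` is, the quotient stays within distance `1` of `1`, so the
    -- principal logarithm applies.
    have hs : ∀ z ∈ T, (z - x) / (z - y) ∈ Complex.slitPlane := by
      intro z hz
      have h1 : ε ≤ dist z x := by
        by_contra h; exact hball (Metric.mem_ball.2 (not_le.1 h)) hz
      have h2 : dist y x < ε / 2 := hy
      have h3 : ε / 2 < dist z y := by
        have := dist_triangle z y x; linarith
      have h4 : (z - x) / (z - y) = 1 + (y - x) / (z - y) := by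
        field_simp [hne hyW hz]; ring
      rw [h4]
      refine Complex.mem_slitPlane_of_norm_lt_one ?_
      rw [norm_div, ← dist_eq_norm, ← dist_eq_norm, div_lt_one (by linarith)]
      linarith
    refine ⟨fun z => Complex.log ((z - x) / (z - y)), ?_, fun z hz => ?_⟩
    · refine ContinuousOn.clog ?_ hs
      exact ContinuousOn.div (by fun_prop) (by fun_prop) fun z hz => hne hyW hz
    · exact Complex.exp_log (div_ne_zero (hne hx hz) (hne hyW hz))
  · rintro x y z hx hy hz ⟨g, hg, hg'⟩ ⟨h, hh, hh'⟩
    refine ⟨fun z => g z + h z, hg.add hh, fun w hw => ?_⟩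
    rw [Complex.exp_add, hg' w hw, hh' w hw]
    exact div_mul_div_cancel₀ (hne hy hw)
  · rintro x y hx hy ⟨g, hg, hg'⟩
    refine ⟨fun z => - g z, hg.neg, fun w hw => ?_⟩
    rw [Complex.exp_neg, hg' w hw, inv_div]

theorem add_mul_exp_mem_slitPlane {r s θ : ℝ} (hrs : 0 < r + s)
    (h1 : -Real.pi < θ) (h2 : θ < Real.pi) :
    (r : ℂ) + s * Complex.exp (θ * Complex.I) ∈ Complex.slitPlane := by
  rw [Complex.mem_slitPlane_iff]
  by_cases h : s * Real.sin θ = 0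
  · left
    have : 0 < r + s * Real.cos θ := by
      rcases mul_eq_zero.1 h with h | h
      · rw [h, zero_mul]; linarith
      · rw [(Real.sin_eq_zero_iff_of_lt_of_lt h1 h2).1 h, Real.cos_zero]; linarith
    simpa [Complex.exp_mul_I, ← Complex.ofReal_cos, ← Complex.ofReal_sin] using this
  · right
    simpa [Complex.exp_mul_I, ← Complex.ofReal_cos, ← Complex.ofReal_sin] using h

theorem tendsto_arg_add_mul_exp {ρ θ : ℝ} (hρ : 0 < ρ) (h1 : -Real.pi < θ) (h2 : θ < Real.pi) :
    Tendsto (fun r : ℝ => Complex.arg ((r : ℂ) + ρ * Complex.exp (θ * Complex.I)))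
      (𝓝[>] 0) (𝓝 θ) := by
  have hm := add_mul_exp_mem_slitPlane (r := 0) (s := ρ) (by linarith) h1 h2
  have hc : ContinuousAt (fun r : ℝ => Complex.arg ((r : ℂ) + ρ * Complex.exp (θ * Complex.I))) 0 :=
    ContinuousAt.comp (f := fun r : ℝ => (r : ℂ) + ρ * Complex.exp (θ * Complex.I))
      (Complex.continuousAt_arg hm) (by fun_prop)
  have h3 := hc.tendsto.mono_left (nhdsWithin_le_nhds (s := Ioi 0))
  have h4 : Complex.arg (((0 : ℝ) : ℂ) + ρ * Complex.exp (θ * Complex.I)) = θ := by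
    rw [Complex.ofReal_zero, zero_add, Complex.exp_mul_I]
    exact Complex.arg_mul_cos_add_sin_mul_I hρ ⟨h1, h2.le⟩
  rwa [h4] at h3

/-- Two disjoint connected sets, one of them open, cannot contain alternating sectors at a common
boundary point: a path in `V` closed up through `c` would separate the two sectors of `W`. -/
theorem not_alternating_rays {V W : Set ℂ} (hV : IsOpen V) (hVc : IsPreconnected V)
    (hWc : IsPreconnected W) (hVW : Disjoint V W) {c e : ℂ} (hcV : c ∉ V) (hcW : c ∉ W)
    (he : ‖e‖ = 1) {α ρ : ℝ} (hα : 0 < α) (hα2 : α ≤ Real.pi / 2) (hρ : 0 < ρ)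
    (h0 : ∀ s : ℝ, 0 < s → s ≤ ρ → c + s * e ∈ V)
    (h1 : ∀ s : ℝ, 0 < s → s ≤ ρ → c + s * (e * Complex.exp (α * Complex.I)) ∈ W)
    (h2 : ∀ s : ℝ, 0 < s → s ≤ ρ → c + s * (e * Complex.exp (α * Complex.I) ^ 2) ∈ V)
    (h3 : ∀ s : ℝ, 0 < s → s ≤ ρ → c + s * (e * Complex.exp (α * Complex.I) ^ 3) ∈ W) : False := by
  set q : ℂ := Complex.exp (α * Complex.I) with hq
  have hpi := Real.pi_pos
  have hq0 : q ≠ 0 := Complex.exp_ne_zero _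
  have he0 : e ≠ 0 := by rintro rfl; simp at he
  have hqn : ‖q‖ = 1 := Complex.norm_exp_ofReal_mul_I α
  have hv1 := h0 ρ hρ le_rfl
  have hv2 := h2 ρ hρ le_rfl
  set v₁ := c + ρ * e with hv₁
  set v₂ := c + ρ * (e * q ^ 2) with hv₂
  have hpc : IsPathConnected V := (hV.isConnected_iff_isPathConnected).1 ⟨⟨_, hv1⟩, hVc⟩
  obtain ⟨γ, hγ⟩ := hpc.joinedIn _ hv1 _ hv2
  set T₀ := range γ with hT₀
  have hT₀V : T₀ ⊆ V := by rintro _ ⟨t, rfl⟩; exact hγ t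
  have hT₀k : IsCompact T₀ := isCompact_range γ.continuous
  have hT₀c : IsPreconnected T₀ := isPreconnected_range γ.continuous
  have hv1T : v₁ ∈ T₀ := ⟨0, γ.source⟩
  have hv2T : v₂ ∈ T₀ := ⟨1, γ.target⟩
  set S₁ := (fun s : ℝ => c + s * e) '' Icc 0 ρ with hS₁
  set S₂ := (fun s : ℝ => c + s * (e * q ^ 2)) '' Icc 0 ρ with hS₂
  have hS₁k : IsCompact S₁ := isCompact_Icc.image (by fun_prop)
  have hS₂k : IsCompact S₂ := isCompact_Icc.image (by fun_prop)
  have hSc : IsPreconnected (S₁ ∪ S₂) := by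
    refine IsPreconnected.union c ⟨0, ⟨le_rfl, hρ.le⟩, by simp⟩ ⟨0, ⟨le_rfl, hρ.le⟩, by simp⟩ ?_ ?_
    · exact isPreconnected_Icc.image _ (by fun_prop)
    · exact isPreconnected_Icc.image _ (by fun_prop)
  have hv1S : v₁ ∈ S₁ ∪ S₂ := Or.inl ⟨ρ, ⟨hρ.le, le_rfl⟩, rfl⟩
  have hv2S : v₂ ∈ S₁ ∪ S₂ := Or.inr ⟨ρ, ⟨hρ.le, le_rfl⟩, rfl⟩
  have hTk : IsCompact (T₀ ∪ (S₁ ∪ S₂)) := hT₀k.union (hS₁k.union hS₂k)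
  have hSsub : S₁ ∪ S₂ ⊆ insert c V := by
    rintro z (⟨s, ⟨hs0, hs1⟩, rfl⟩ | ⟨s, ⟨hs0, hs1⟩, rfl⟩)
    · rcases hs0.eq_or_lt with h | h
      · left; simp [← h]
      · right; exact h0 s h hs1
    · rcases hs0.eq_or_lt with h | h
      · left; simp [← h]
      · right; exact h2 s h hs1
  have hWT : Disjoint W (T₀ ∪ (S₁ ∪ S₂)) := by
    rw [Set.disjoint_left]
    rintro x hx (h | h)
    · exact Set.disjoint_left.1 hVW (hT₀V h) hx
    · rcases hSsub h with h | h
      · exact hcW (h ▸ hx)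
      · exact Set.disjoint_left.1 hVW h hx
  -- The path keeps a distance `ρ₀` from `c`. With `r < ρ₀ / 3`, the points `p` and `p'` at distance
  -- `r` from `c` are then almost indistinguishable as seen from the path.
  obtain ⟨ρ₀, hρ₀, hball⟩ := Metric.isOpen_iff.1 hT₀k.isClosed.isOpen_compl c
    (fun h => hcV (hT₀V h))
  -- This is the change of the argument of `(z - p) / (z - p')` along the two segments through `c`.
  -- Its limit is `2π`, so for small `r` it exceeds `π`. Along the path the same change is below
  -- `π`, because the quotient stays in the right half plane.
  have hlim : Tendsto (fun r : ℝ =>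
      Complex.arg ((r : ℂ) + ρ * Complex.exp ((Real.pi - α : ℝ) * Complex.I))
      - Complex.arg ((r : ℂ) + ρ * Complex.exp ((Real.pi - 3 * α : ℝ) * Complex.I))
      - (Complex.arg ((r : ℂ) + ρ * Complex.exp ((α - Real.pi : ℝ) * Complex.I))
      - Complex.arg ((r : ℂ) + ρ * Complex.exp ((Real.pi - α : ℝ) * Complex.I))))
      (𝓝[>] 0) (𝓝 ((Real.pi - α) - (Real.pi - 3 * α) - ((α - Real.pi) - (Real.pi - α)))) := by
    refine ((tendsto_arg_add_mul_exp hρ ?_ ?_).sub (tendsto_arg_add_mul_exp hρ ?_ ?_)).sub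
      ((tendsto_arg_add_mul_exp hρ ?_ ?_).sub (tendsto_arg_add_mul_exp hρ ?_ ?_)) <;> linarith
  have hev := hlim.eventually (lt_mem_nhds (a := Real.pi) (by linarith))
  have hr1 : ∀ᶠ r : ℝ in 𝓝[>] 0, r ∈ Ioo 0 (min ρ (ρ₀ / 3)) :=
    Ioo_mem_nhdsGT (lt_min hρ (by linarith))
  obtain ⟨r, hr, hr0, hrlt⟩ := (hev.and hr1).exists
  have hrρ : r < ρ := hrlt.trans_le (min_le_left _ _)
  have hrρ₀ : r < ρ₀ / 3 := hrlt.trans_le (min_le_right _ _)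
  set p := c + r * (e * q) with hp
  set p' := c + r * (e * q ^ 3) with hp'
  have hpW : p ∈ W := h1 r hr0 hrρ.le
  have hp'W : p' ∈ W := h3 r hr0 hrρ.le
  have hpc : ‖p - c‖ = r := by simp [hp, he, hqn, abs_of_pos hr0]
  have hp'c : ‖p' - c‖ = r := by simp [hp', he, hqn, abs_of_pos hr0]
  obtain ⟨g, hg, hge⟩ := exists_continuousOn_log_sub_div_sub hTk hWc hWT hpW hp'W
  have hne' : ∀ z ∈ T₀ ∪ (S₁ ∪ S₂), z - p' ≠ 0 := fun z hz h =>
    Set.disjoint_left.1 hWT hp'W (sub_eq_zero.1 h ▸ hz)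
  have hne : ∀ z ∈ T₀ ∪ (S₁ ∪ S₂), z - p ≠ 0 := fun z hz h =>
    Set.disjoint_left.1 hWT hpW (sub_eq_zero.1 h ▸ hz)
  -- comparison along the path
  have hre : ∀ z ∈ T₀, 0 < ((z - p) / (z - p')).re := by
    intro z hz
    have hz1 : ρ₀ ≤ ‖z - c‖ := by
      by_contra h
      exact hball (by rw [Metric.mem_ball, dist_eq_norm]; exact not_le.1 h) hz
    have hz2 : ‖z - c‖ ≤ ‖z - p'‖ + ‖p' - c‖ := norm_sub_le_norm_sub_add_norm_sub _ _ _
    have hz3 : ‖p' - p‖ ≤ ‖p' - c‖ + ‖p - c‖ := by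
      have := norm_sub_le_norm_sub_add_norm_sub p' c p
      rwa [norm_sub_rev c p] at this
    have h4 : (z - p) / (z - p') = 1 + (p' - p) / (z - p') := by
      field_simp [hne' z (Or.inl hz)]; ring
    have h5 : ‖(p' - p) / (z - p')‖ < 1 := by
      rw [norm_div, div_lt_one (by linarith)]; linarith
    have h6 := Complex.abs_re_le_norm ((p' - p) / (z - p'))
    have h7 := abs_le.1 (h6.trans h5.le)
    rw [h4, Complex.add_re, Complex.one_re]
    have := (abs_lt.1 (h6.trans_lt h5)).1
    linarith
  have e1 := hT₀c.sub_eq_of_exp_eq (c := 1) (g := g)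
    (h := fun z => Complex.log ((z - p) / (z - p')))
    (hg.mono subset_union_left)
    (ContinuousOn.clog (ContinuousOn.div (by fun_prop) (by fun_prop) fun z hz => hne' z (Or.inl hz))
      fun z hz => Or.inl (hre z hz))
    (fun z hz => by
      rw [one_mul, Complex.exp_log (div_ne_zero (hne z (Or.inl hz)) (hne' z (Or.inl hz))),
        hge z (Or.inl hz)]) hv1T hv2T
  have a1 := Complex.abs_arg_lt_pi_div_two_iff.2 (Or.inl (hre _ hv1T))
  have a2 := Complex.abs_arg_lt_pi_div_two_iff.2 (Or.inl (hre _ hv2T))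
  -- comparison along the rays
  have hE : ∀ θ : ℝ, Complex.exp ((Real.pi - θ :
      ℝ) * Complex.I) = - Complex.exp (-(θ * Complex.I)) := by
    intro θ
    rw [Complex.ofReal_sub, sub_mul, Complex.exp_sub, Complex.exp_pi_mul_I, Complex.exp_neg]
    ring
  have hEa : Complex.exp ((Real.pi - α : ℝ) * Complex.I) = - q⁻¹ := by
    rw [hE, Complex.exp_neg]
  have hEb : Complex.exp ((Real.pi - 3 * α : ℝ) * Complex.I) = - (q ^ 3)⁻¹ := by
    rw [hE, Complex.exp_neg, hq, ← Complex.exp_nat_mul]; push_cast; ring_nf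
  have hEc : Complex.exp ((α - Real.pi : ℝ) * Complex.I) = - q := by
    rw [Complex.ofReal_sub, sub_mul, Complex.exp_sub, Complex.exp_pi_mul_I, div_neg, div_one]
  have k1 : ∀ s : ℝ, -((c + s * e) - p) / (e * q)
      = (r : ℂ) + s * Complex.exp ((Real.pi - α : ℝ) * Complex.I) := by
    intro s; rw [hEa, hp]; field_simp; ring
  have k2 : ∀ s : ℝ, -((c + s * e) - p') / (e * q ^ 3)
      = (r : ℂ) + s * Complex.exp ((Real.pi - 3 * α : ℝ) * Complex.I) := by
    intro s; rw [hEb, hp']; field_simp; ring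
  have k3 : ∀ s : ℝ, -((c + s * (e * q ^ 2)) - p) / (e * q)
      = (r : ℂ) + s * Complex.exp ((α - Real.pi : ℝ) * Complex.I) := by
    intro s; rw [hEc, hp]; field_simp; ring
  have k4 : ∀ s : ℝ, -((c + s * (e * q ^ 2)) - p') / (e * q ^ 3)
      = (r : ℂ) + s * Complex.exp ((Real.pi - α : ℝ) * Complex.I) := by
    intro s; rw [hEa, hp']; field_simp; ring
  have hs1 : ∀ z ∈ S₁ ∪ S₂, -(z - p) / (e * q) ∈ Complex.slitPlane := by
    rintro z (⟨s, ⟨hs, -⟩, rfl⟩ | ⟨s, ⟨hs, -⟩, rfl⟩)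
    · rw [k1]; apply add_mul_exp_mem_slitPlane <;> linarith
    · rw [k3]; apply add_mul_exp_mem_slitPlane <;> linarith
  have hs2 : ∀ z ∈ S₁ ∪ S₂, -(z - p') / (e * q ^ 3) ∈ Complex.slitPlane := by
    rintro z (⟨s, ⟨hs, -⟩, rfl⟩ | ⟨s, ⟨hs, -⟩, rfl⟩)
    · rw [k2]; apply add_mul_exp_mem_slitPlane <;> linarith
    · rw [k4]; apply add_mul_exp_mem_slitPlane <;> linarith
  -- Dividing by the directions `e * q` and `e * q ^ 3` moves both factors into the slit plane. The
  -- constant `(q ^ 2)⁻¹` compensates for the different directions.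
  have e2 := hSc.sub_eq_of_exp_eq (c := (q ^ 2)⁻¹) (g := g)
    (h := fun z => Complex.log (-(z - p) / (e * q)) - Complex.log (-(z - p') / (e * q ^ 3)))
    (hg.mono subset_union_right)
    ((ContinuousOn.clog (by fun_prop) hs1).sub (ContinuousOn.clog (by fun_prop) hs2))
    (fun z hz => by
      rw [Complex.exp_sub, Complex.exp_log (Complex.slitPlane_ne_zero (hs1 z hz)),
        Complex.exp_log (Complex.slitPlane_ne_zero (hs2 z hz)), hge z (Or.inr hz)]
      have := hne' z (Or.inr hz)
      field_simp) hv1S hv2S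
  have i1 := congrArg Complex.im e1
  have i2 := congrArg Complex.im e2
  simp only [Complex.sub_im, Complex.log_im] at i1 i2
  rw [k1, k2, k3, k4] at i2
  have b1 := abs_lt.1 a1
  have b2 := abs_lt.1 a2
  linarith [b1.1, b1.2, b2.1, b2.2]

/-! ### Faces of compact connected sets -/

/-- A preconnected set which meets `T` but not its frontier is contained in `T`. -/
theorem IsPreconnected.subset_of_disjoint_frontier {X : Type*} [TopologicalSpace X] {S T : Set X}
    (hS : IsPreconnected S) (hne : (S ∩ T).Nonempty) (hd : Disjoint S (frontier T)) : S ⊆ T := by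
  have hcov : S ⊆ interior T ∪ (closure T)ᶜ := by
    intro x hx
    by_cases h : x ∈ closure T
    · left
      by_contra h'
      exact Set.disjoint_left.1 hd hx ⟨h, h'⟩
    · exact Or.inr h
  have hdj : Disjoint (interior T) (closure T)ᶜ :=
    disjoint_compl_right.mono_left (interior_subset.trans subset_closure)
  obtain ⟨x, hx, hxT⟩ := hne
  refine (hS.subset_left_of_subset_union isOpen_interior isClosed_closure.isOpen_compl hdj hcov
    ⟨x, hx, ?_⟩).trans interior_subset
  exact (hcov hx).resolve_right fun h => h (subset_closure hxT)

/-- A frontier point inside the open set `F` would have an open component meeting this one, hence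
equal to it, and would then be interior. -/
theorem frontier_connectedComponentIn_subset {F : Set ℂ} (hF : IsOpen F) (x : ℂ) :
    frontier (connectedComponentIn F x) ⊆ Fᶜ := by
  intro w hw hwF
  have ho : IsOpen (connectedComponentIn F x) := hF.connectedComponentIn
  rw [ho.frontier_eq] at hw
  obtain ⟨y, hy1, hy2⟩ := mem_closure_iff.1 hw.1 _ (hF.connectedComponentIn (x := w))
    (mem_connectedComponentIn hwF)
  apply hw.2
  rw [connectedComponentIn_eq hy2, ← connectedComponentIn_eq hy1]
  exact mem_connectedComponentIn hwF

theorem isPreconnected_compl_closedBall_zero (r : ℝ) :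
    IsPreconnected (Metric.closedBall (0 : ℂ) r)ᶜ := by
  rcases lt_or_ge r 0 with hr | hr
  · rw [Metric.closedBall_eq_empty.2 hr, compl_empty]; exact isPreconnected_univ
  have h1 : IsPreconnected (Metric.sphere (0 : ℂ) 1 ×ˢ Ioi r) :=
    (isPreconnected_sphere (by simp [Complex.rank_real_complex]) _ _).prod isPreconnected_Ioi
  have h2 := h1.image (fun p : ℂ × ℝ => (p.2 : ℂ) * p.1) (by fun_prop)
  convert h2 using 1
  ext z
  simp only [mem_compl_iff, Metric.mem_closedBall, dist_zero_right, not_le, mem_image, mem_prod,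
    mem_sphere_zero_iff_norm, mem_Ioi, Prod.exists]
  constructor
  · intro hz
    have hz0 : (‖z‖ : ℂ) ≠ 0 := by
      exact_mod_cast (hr.trans_lt hz).ne'
    refine ⟨z / ‖z‖, ‖z‖, ⟨?_, hz⟩, ?_⟩
    · rw [norm_div, Complex.norm_real, norm_norm, div_self]; exact_mod_cast hz0
    · field_simp
  · rintro ⟨u, s, ⟨hu, hs⟩, rfl⟩
    rw [norm_mul, hu, mul_one, Complex.norm_real, Real.norm_eq_abs]
    exact hs.trans_le (le_abs_self s)

theorem exists_norm_gt_notMem {S : Set ℂ} (hS : ¬ Bornology.IsBounded S) (R : ℝ) :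
    ∃ z ∈ S, R < ‖z‖ := by
  by_contra h
  push Not at h
  exact hS ((Metric.isBounded_closedBall (x := (0 : ℂ)) (r := R)).subset
    fun z hz => by simpa using h z hz)

theorem not_isBounded_compl_closedBall (R : ℝ) :
    ¬ Bornology.IsBounded (Metric.closedBall (0 : ℂ) R)ᶜ := by
  intro h
  have : Bornology.IsBounded (univ : Set ℂ) := by
    rw [← union_compl_self (Metric.closedBall (0 : ℂ) R)]
    exact Metric.isBounded_closedBall.union h
  exact NormedSpace.unbounded_univ ℝ ℂ this

/-- The union of the unbounded components of the complement. -/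
def outerFace (M : Set ℂ) : Set ℂ :=
  {z | z ∈ Mᶜ ∧ ¬ Bornology.IsBounded (connectedComponentIn Mᶜ z)}

/-- `M` together with the bounded components of its complement. -/
def filled (M : Set ℂ) : Set ℂ := (outerFace M)ᶜ

/-- The union of the bounded components of the complement. -/
def enclosed (M : Set ℂ) : Set ℂ := filled M \ M

section Faces

variable {M M' S : Set ℂ}

theorem mem_enclosed {z : ℂ} :
    z ∈ enclosed M ↔ z ∉ M ∧ Bornology.IsBounded (connectedComponentIn Mᶜ z) := by
  simp only [enclosed, filled, outerFace, Set.mem_sdiff, mem_compl_iff, mem_ofPred_eq]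
  tauto

theorem subset_filled : M ⊆ filled M := fun _ hz h => h.1 hz

theorem enclosed_subset_filled : enclosed M ⊆ filled M := sdiff_subset

theorem enclosed_subset_compl : enclosed M ⊆ Mᶜ := fun _ h => h.2

theorem mem_filled_cases {z : ℂ} (hz : z ∈ filled M) : z ∈ M ∨ z ∈ enclosed M := by
  by_cases h : z ∈ M
  · exact Or.inl h
  · exact Or.inr ⟨hz, h⟩

theorem IsPreconnected.subset_enclosed (hS : IsPreconnected S) (hd : S ⊆ Mᶜ)
    (hne : (S ∩ filled M).Nonempty) : S ⊆ enclosed M := by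
  obtain ⟨x, hx, hxM⟩ := hne
  have hxi : x ∈ enclosed M := ⟨hxM, hd hx⟩
  intro y hy
  have hy' := hS.subset_connectedComponentIn hx hd hy
  rw [mem_enclosed] at hxi ⊢
  refine ⟨hd hy, ?_⟩
  rw [← connectedComponentIn_eq hy']
  exact hxi.2

theorem IsPreconnected.subset_outerFace (hS : IsPreconnected S) (hd : S ⊆ Mᶜ)
    (hne : (S ∩ outerFace M).Nonempty) : S ⊆ outerFace M := by
  intro y hy
  by_contra h
  obtain ⟨x, hx, hxM⟩ := hne
  exact (hS.subset_enclosed hd ⟨y, hy, h⟩ hx).1 hxM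

theorem connectedComponentIn_subset_enclosed {z : ℂ} (hz : z ∈ enclosed M) :
    connectedComponentIn Mᶜ z ⊆ enclosed M :=
  isPreconnected_connectedComponentIn.subset_enclosed (connectedComponentIn_subset _ _)
    ⟨z, mem_connectedComponentIn hz.2, hz.1⟩

theorem connectedComponentIn_subset_outerFace {z : ℂ} (hz : z ∈ outerFace M) :
    connectedComponentIn Mᶜ z ⊆ outerFace M :=
  isPreconnected_connectedComponentIn.subset_outerFace (connectedComponentIn_subset _ _)
    ⟨z, mem_connectedComponentIn hz.1, hz⟩

theorem isOpen_outerFace (hM : IsClosed M) : IsOpen (outerFace M) := by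
  rw [isOpen_iff_mem_nhds]
  intro z hz
  exact mem_of_superset (hM.isOpen_compl.connectedComponentIn.mem_nhds
    (mem_connectedComponentIn hz.1)) (connectedComponentIn_subset_outerFace hz)

theorem isOpen_enclosed (hM : IsClosed M) : IsOpen (enclosed M) := by
  rw [isOpen_iff_mem_nhds]
  intro z hz
  exact mem_of_superset (hM.isOpen_compl.connectedComponentIn.mem_nhds
    (mem_connectedComponentIn hz.2)) (connectedComponentIn_subset_enclosed hz)

theorem compl_closedBall_subset_outerFace {R : ℝ} (h : M ⊆ Metric.closedBall 0 R) :
    (Metric.closedBall (0 : ℂ) R)ᶜ ⊆ outerFace M := by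
  intro z hz
  refine ⟨fun hzM => hz (h hzM), fun hb => ?_⟩
  exact not_isBounded_compl_closedBall R (hb.subset
    ((isPreconnected_compl_closedBall_zero R).subset_connectedComponentIn hz
      (compl_subset_compl.2 h)))

theorem filled_subset_closedBall {R : ℝ} (h : M ⊆ Metric.closedBall 0 R) :
    filled M ⊆ Metric.closedBall 0 R :=
  compl_subset_comm.1 (compl_closedBall_subset_outerFace h)

theorem isBounded_filled (hM : Bornology.IsBounded M) : Bornology.IsBounded (filled M) := by
  obtain ⟨R, hR⟩ := hM.subset_closedBall 0
  exact Metric.isBounded_closedBall.subset (filled_subset_closedBall hR)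

theorem isCompact_filled (hM : IsCompact M) : IsCompact (filled M) :=
  Metric.isCompact_of_isClosed_isBounded (isOpen_outerFace hM.isClosed).isClosed_compl
    (isBounded_filled hM.isBounded)

theorem outerFace_nonempty (hM : Bornology.IsBounded M) : (outerFace M).Nonempty := by
  by_contra h
  rw [not_nonempty_iff_eq_empty] at h
  have := isBounded_filled hM
  rw [filled, h, compl_empty] at this
  exact NormedSpace.unbounded_univ ℝ ℂ this

/-- Every unbounded component leaves a large ball containing `M`, and the exterior of that ball is
connected, so there is only one such component. -/
theorem outerFace_eq_connectedComponentIn (hM : Bornology.IsBounded M) {x : ℂ} (hx :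
    x ∈ outerFace M) :
    outerFace M = connectedComponentIn Mᶜ x := by
  refine (Subset.antisymm (fun y hy => ?_) (connectedComponentIn_subset_outerFace hx))
  obtain ⟨R, hR⟩ := hM.subset_closedBall 0
  have key : ∀ z ∈ outerFace M, (Metric.closedBall (0 : ℂ) R)ᶜ ⊆ connectedComponentIn Mᶜ z := by
    intro z hz
    obtain ⟨p, hp, hpR⟩ := exists_norm_gt_notMem hz.2 R
    rw [connectedComponentIn_eq hp]
    exact (isPreconnected_compl_closedBall_zero R).subset_connectedComponentIn
      (by simpa using hpR) (compl_subset_compl.2 hR)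
  obtain ⟨p, hp⟩ : ((Metric.closedBall (0 : ℂ) R)ᶜ).Nonempty := by
    by_contra h
    rw [not_nonempty_iff_eq_empty] at h
    exact not_isBounded_compl_closedBall R (h ▸ Bornology.isBounded_empty)
  rw [connectedComponentIn_eq (key x hx hp), ← connectedComponentIn_eq (key y hy hp)]
  exact mem_connectedComponentIn hy.1

theorem isPreconnected_outerFace (hM : Bornology.IsBounded M) : IsPreconnected (outerFace M) := by
  obtain ⟨x, hx⟩ := outerFace_nonempty hM
  rw [outerFace_eq_connectedComponentIn hM hx]
  exact isPreconnected_connectedComponentIn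

theorem isFace_outerFace (hM : Bornology.IsBounded M) : IsFace M (outerFace M) := by
  obtain ⟨x, hx⟩ := outerFace_nonempty hM
  exact ⟨x, hx.1, outerFace_eq_connectedComponentIn hM hx⟩

theorem not_isBounded_outerFace (hM : Bornology.IsBounded M) :
    ¬ Bornology.IsBounded (outerFace M) := by
  obtain ⟨x, hx⟩ := outerFace_nonempty hM
  rw [outerFace_eq_connectedComponentIn hM hx]
  exact hx.2

/-- The union of a connected closed set with some of its faces is connected. -/
theorem isPreconnected_of_union_faces (hM : IsClosed M) (hc : IsConnected M) {Y : Set ℂ}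
    (hMY : M ⊆ Y) (hY : ∀ y ∈ Y, y ∉ M → connectedComponentIn Mᶜ y ⊆ Y) : IsPreconnected Y := by
  obtain ⟨m, hm⟩ := hc.nonempty
  refine isPreconnected_of_forall m fun y hy => ?_
  by_cases hyM : y ∈ M
  · exact ⟨M, hMY, hm, hyM, hc.isPreconnected⟩
  set V := connectedComponentIn Mᶜ y with hV
  have hyV : y ∈ V := mem_connectedComponentIn hyM
  have hfr : (frontier V).Nonempty := by
    rw [nonempty_frontier_iff]
    refine ⟨⟨y, hyV⟩, fun h => ?_⟩
    have : m ∈ V := h ▸ mem_univ m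
    exact connectedComponentIn_subset _ _ this hm
  obtain ⟨w, hw⟩ := hfr
  have hwM : w ∈ M := not_not.1 (frontier_connectedComponentIn_subset hM.isOpen_compl y hw)
  have h1 : IsPreconnected (insert w V) :=
    isPreconnected_connectedComponentIn.subset_closure (subset_insert _ _)
      (insert_subset (frontier_subset_closure hw) subset_closure)
  refine ⟨M ∪ insert w V, ?_, Or.inl hm, Or.inr (mem_insert_of_mem _ hyV),
    hc.isPreconnected.union w hwM (mem_insert _ _) h1⟩
  exact union_subset hMY (insert_subset (hMY hwM) (hY y hy hyM))

theorem isPreconnected_filled (hM : IsClosed M) (hc : IsConnected M) :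
    IsPreconnected (filled M) :=
  isPreconnected_of_union_faces hM hc subset_filled fun _ hy hyM =>
    (connectedComponentIn_subset_enclosed ⟨hy, hyM⟩).trans enclosed_subset_filled

/-- The complement of the face `V` is `M` together with the other faces, hence connected. It avoids
`M'` and reaches infinity, so it lies in the outer face of `M'`. -/
theorem filled_subset_connectedComponentIn (hM : IsCompact M) (hc : IsConnected M)
    (hM' : IsCompact M') (hc' : IsPreconnected M') (hsub : M' ⊆ enclosed M) {x : ℂ} (hx : x ∈ M') :
    filled M' ⊆ connectedComponentIn Mᶜ x := by
  set V := connectedComponentIn Mᶜ x with hV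
  have hM'V : M' ⊆ V := hc'.subset_connectedComponentIn hx (hsub.trans enclosed_subset_compl)
  have hVb : Bornology.IsBounded V := (mem_enclosed.1 (hsub hx)).2
  have hVc : IsPreconnected Vᶜ := by
    refine isPreconnected_of_union_faces hM.isClosed hc
      (fun m hm h => connectedComponentIn_subset _ _ h hm) fun y hy hyM z hz hzV => hy ?_
    rw [hV, connectedComponentIn_eq hzV, ← connectedComponentIn_eq hz]
    exact mem_connectedComponentIn hyM
  obtain ⟨R, hR⟩ := (hVb.union hM'.isBounded).subset_closedBall 0
  obtain ⟨p, hp, -⟩ := exists_norm_gt_notMem (not_isBounded_compl_closedBall R) 0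
  have := hVc.subset_outerFace (M := M') (compl_subset_compl.2 hM'V)
    ⟨p, fun h => hp (hR (Or.inl h)),
      compl_closedBall_subset_outerFace (subset_union_right.trans hR) hp⟩
  exact compl_subset_comm.1 this

theorem filled_subset_enclosed (hM : IsCompact M) (hc : IsConnected M)
    (hM' : IsCompact M') (hc' : IsConnected M') (hsub : M' ⊆ enclosed M) :
    filled M' ⊆ enclosed M := by
  obtain ⟨x, hx⟩ := hc'.nonempty
  exact (filled_subset_connectedComponentIn hM hc hM' hc'.isPreconnected hsub hx).trans
    (connectedComponentIn_subset_enclosed (hsub hx))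

/-- Two disjoint continua that surround a common point are nested. -/
theorem nested_of_mem_filled (hM : IsCompact M) (hc : IsConnected M)
    (hM' : IsCompact M') (hc' : IsConnected M') (hd : Disjoint M M') {o : ℂ}
    (ho : o ∈ filled M) (ho' : o ∈ filled M') :
    filled M' ⊆ enclosed M ∨ filled M ⊆ enclosed M' := by
  by_cases h1 : (M' ∩ filled M).Nonempty
  · exact Or.inl (filled_subset_enclosed hM hc hM' hc'
      (hc'.isPreconnected.subset_enclosed hd.subset_compl_left h1))
  · right
    refine (isPreconnected_filled hM.isClosed hc).subset_enclosed (fun z hz hz' => h1 ⟨z, hz', hz⟩)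
      ⟨o, ho, ho'⟩

end Faces

/-! ### Isolating neighbourhoods of compact components -/

/-- A compact component of a closed set has arbitrarily small neighbourhoods whose frontiers miss
the closed set. -/
theorem exists_isolating_nhds {X O : Set ℂ} (hX : IsClosed X) {x : ℂ} (hx : x ∈ X)
    (hk : IsCompact (connectedComponentIn X x)) (hO : IsOpen O)
    (hsub : connectedComponentIn X x ⊆ O) :
    ∃ N, IsOpen N ∧ connectedComponentIn X x ⊆ N ∧ IsCompact (closure N) ∧ closure N ⊆ O ∧
      Disjoint (frontier N) X := by
  set M := connectedComponentIn X x with hM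
  obtain ⟨δ, hδ, hδO⟩ := hk.exists_cthickening_subset_open hO hsub
  set Z := X ∩ Metric.cthickening δ M with hZ
  have hZk : IsCompact Z := hk.cthickening.inter_left hX
  have hxM : x ∈ M := mem_connectedComponentIn hx
  have hMZ : M ⊆ Z := subset_inter (connectedComponentIn_subset _ _) (
      Metric.self_subset_cthickening M)
  have hxZ : x ∈ Z := hMZ hxM
  have : CompactSpace Z := isCompact_iff_compactSpace.1 hZk
  have hcomp : connectedComponentIn Z x ⊆ M :=
    connectedComponentIn_mono x inter_subset_left
  rw [connectedComponentIn_eq_image hxZ] at hcomp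
  have hdir : Directed (· ⊇ ·) fun s : { s : Set Z // IsClopen s ∧ (⟨x, hxZ⟩ : Z) ∈ s } => s.1 := by
    intro a b
    exact ⟨⟨a.1 ∩ b.1, a.2.1.inter b.2.1, a.2.2, b.2.2⟩, inter_subset_left, inter_subset_right⟩
  have : Nonempty { s : Set Z // IsClopen s ∧ (⟨x, hxZ⟩ : Z) ∈ s } :=
    ⟨⟨univ, isClopen_univ, mem_univ _⟩⟩
  -- In the compact space `Z` the component is the intersection of the clopen sets containing it, so
  -- by compactness one of these clopen sets already lies in the thickening.
  obtain ⟨⟨Q, hQ, hxQ⟩, hQsub⟩ := exists_subset_nhds_of_compactSpace hdir (fun s => s.2.1.1)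
    (U := (Subtype.val ⁻¹' Metric.thickening δ M : Set Z)) (fun y hy => by
      rw [← connectedComponent_eq_iInter_isClopen] at hy
      exact (Metric.isOpen_thickening.preimage continuous_subtype_val).mem_nhds
        (Metric.self_subset_thickening hδ M (hcomp ⟨y, hy, rfl⟩)))
  set Q₁ : Set ℂ := Subtype.val '' Q
  set Q₂ : Set ℂ := Subtype.val '' Qᶜ
  have hQ₁ : IsCompact Q₁ := hQ.1.isCompact.image continuous_subtype_val
  have hQ₂ : IsCompact Q₂ := hQ.compl.1.isCompact.image continuous_subtype_val
  have hQ₁O : Q₁ ⊆ Metric.thickening δ M ∩ Q₂ᶜ := by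
    rintro _ ⟨y, hy, rfl⟩
    refine ⟨hQsub hy, ?_⟩
    rintro ⟨y', hy', h⟩
    exact hy' (Subtype.val_injective h ▸ hy)
  -- The neighbourhood avoids `Q₂`, so any point of `X` in its closure belongs to `Q₁` and is not on
  -- its frontier.
  obtain ⟨ε, hε, hεO⟩ := hQ₁.exists_cthickening_subset_open
    (Metric.isOpen_thickening.inter hQ₂.isClosed.isOpen_compl) hQ₁O
  have hMQ : M ⊆ Q₁ := by
    intro y hy
    by_contra h
    have hyZ := hMZ hy
    have h1 : IsPreconnected (Subtype.val ⁻¹' M : Set Z) := by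
      have : Topology.IsInducing (Subtype.val : Z → ℂ) := Topology.IsInducing.subtypeVal
      rw [← this.isPreconnected_image, Subtype.image_preimage_coe, inter_eq_right.2 hMZ]
      exact isPreconnected_connectedComponentIn
    have := h1.subset_isClopen hQ ⟨⟨x, hxZ⟩, hxM, hxQ⟩
    exact h ⟨⟨y, hyZ⟩, this hy, rfl⟩
  have hcl : closure (Metric.thickening ε Q₁) ⊆ Metric.cthickening ε Q₁ :=
    Metric.closure_thickening_subset_cthickening ε Q₁
  refine ⟨Metric.thickening ε Q₁, Metric.isOpen_thickening,
    hMQ.trans (Metric.self_subset_thickening hε _),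
    hQ₁.cthickening.of_isClosed_subset isClosed_closure hcl, ?_, ?_⟩
  · exact (hcl.trans hεO).trans (inter_subset_left.trans
      ((Metric.thickening_subset_cthickening δ M).trans hδO))
  · rw [Set.disjoint_left]
    intro w hw hwX
    have hw1 := hεO (hcl (frontier_subset_closure hw))
    have hwZ : w ∈ Z := ⟨hwX, Metric.thickening_subset_cthickening δ M hw1.1⟩
    have hwQ : w ∈ Q₁ := by
      by_contra h
      exact hw1.2 ⟨⟨w, hwZ⟩, fun hq => h ⟨_, hq, rfl⟩, rfl⟩
    rw [Metric.isOpen_thickening.frontier_eq] at hw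
    exact hw.2 (Metric.self_subset_thickening hε _ hwQ)

/-! ### The modulus of a meromorphic function -/

theorem extMod_of_analyticAt {f : ℂ → ℂ} {z : ℂ} (h : AnalyticAt ℂ f z) :
    extMod f z = ‖f z‖ₑ := by
  rw [extMod, if_neg (not_lt.2 h.meromorphicOrderAt_nonneg)]

theorem extMod_ne_top_of_analyticAt {f : ℂ → ℂ} {z : ℂ} (h : AnalyticAt ℂ f z) :
    extMod f z ≠ ⊤ := by
  rw [extMod_of_analyticAt h]; exact enorm_ne_top

theorem MeromorphicNFAt.analyticAt_of_extMod_ne_top {f : ℂ → ℂ} {z : ℂ}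
    (h : MeromorphicNFAt f z) (ht : extMod f z ≠ ⊤) : AnalyticAt ℂ f z := by
  rw [← h.meromorphicOrderAt_nonneg_iff_analyticAt]
  by_contra hlt
  exact ht (if_pos (not_le.1 hlt))

/-- At a pole `‖f‖` tends to infinity, which is exactly the value assigned there; elsewhere normal
form makes `f` analytic. -/
theorem MeromorphicNFAt.continuousAt_extMod {f : ℂ → ℂ} {z : ℂ} (h : MeromorphicNFAt f z) :
    ContinuousAt (extMod f) z := by
  by_cases ht : extMod f z = ⊤
  · have hlt : meromorphicOrderAt f z < 0 := by
      by_contra hlt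
      rw [extMod, if_neg hlt] at ht
      exact enorm_ne_top ht
    rw [continuousAt_iff_punctured_nhds, ht]
    have h1 := tendsto_norm_cobounded_atTop.comp (tendsto_cobounded_of_meromorphicOrderAt_neg hlt)
    have h2 := ENNReal.tendsto_ofReal_nhds_top.2 h1
    refine h2.congr' ?_
    filter_upwards [h.meromorphicAt.eventually_analyticAt] with w hw
    rw [extMod_of_analyticAt hw, Function.comp_apply, ofReal_norm]
  · have ha := h.analyticAt_of_extMod_ne_top ht
    have h1 : ContinuousAt (fun w => ‖f w‖ₑ) z := ha.continuousAt.enorm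
    refine h1.congr ?_
    filter_upwards [ha.eventually_analyticAt] with w hw
    rw [extMod_of_analyticAt hw]

/-- Maximum principle for the modulus. -/
theorem extMod_le_of_forall_frontier {f : ℂ → ℂ} {R : Set ℂ} (hb : Bornology.IsBounded R)
    (ha : ∀ z ∈ closure R, AnalyticAt ℂ f z) {t : ℝ≥0∞}
    (ht : ∀ z ∈ frontier R, extMod f z ≤ t) : ∀ z ∈ closure R, extMod f z ≤ t := by
  intro z hz
  by_cases htop : t = ⊤
  · rw [htop]; exact le_top
  have hd : DiffContOnCl ℂ f R :=
    ⟨fun w hw => (ha w (subset_closure hw)).differentiableAt.differentiableWithinAt,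
      fun w hw => (ha w hw).continuousAt.continuousWithinAt⟩
  have := Complex.norm_le_of_forall_mem_frontier_norm_le hb hd (C := t.toReal) (fun w hw => by
    have h1 := ht w hw
    rw [extMod_of_analyticAt (ha w (frontier_subset_closure hw))] at h1
    have h2 := ENNReal.toReal_mono htop h1
    rwa [toReal_enorm] at h2) hz
  rw [extMod_of_analyticAt (ha z hz), ← ofReal_norm]
  exact ENNReal.ofReal_le_of_le_toReal this

/-- Minimum principle for the modulus. -/
theorem le_extMod_of_forall_frontier {f : ℂ → ℂ} {R : Set ℂ} (hb : Bornology.IsBounded R)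
    (ha : ∀ z ∈ closure R, AnalyticAt ℂ f z) (h0 : ∀ z ∈ closure R, extMod f z ≠ 0) {t : ℝ≥0∞}
    (ht : ∀ z ∈ frontier R, t ≤ extMod f z) : ∀ z ∈ closure R, t ≤ extMod f z := by
  have hf0 : ∀ z ∈ closure R, f z ≠ 0 := fun z hz h => h0 z hz (by
    rw [extMod_of_analyticAt (ha z hz), h, enorm_zero])
  have hai : ∀ z ∈ closure R, AnalyticAt ℂ f⁻¹ z := fun z hz => (ha z hz).inv (hf0 z hz)
  have he : ∀ z ∈ closure R, extMod f⁻¹ z = (extMod f z)⁻¹ := fun z hz => by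
    rw [extMod_of_analyticAt (ha z hz), extMod_of_analyticAt (hai z hz), Pi.inv_apply,
      enorm_inv (hf0 z hz)]
  intro z hz
  have := extMod_le_of_forall_frontier hb hai (t := t⁻¹) (fun w hw => by
    rw [he w (frontier_subset_closure hw)]
    exact ENNReal.inv_le_inv.2 (ht w hw)) z hz
  rw [he z hz] at this
  exact ENNReal.inv_le_inv.1 this

/-- Open mapping theorem for the modulus: it has no local maxima. -/
theorem AnalyticAt.frequently_lt_extMod {f : ℂ → ℂ} {z : ℂ} (ha : AnalyticAt ℂ f z)
    (hc : ¬ ∀ᶠ w in 𝓝 z, f w = f z) : ∃ᶠ w in 𝓝 z, extMod f z < extMod f w := by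
  have hmap := ha.eventually_constant_or_nhds_le_map_nhds.resolve_left hc
  intro hev
  have h1 : Metric.closedBall (0 : ℂ) ‖f z‖ ∈ 𝓝 (f z) := by
    apply hmap
    rw [mem_map]
    filter_upwards [hev, ha.eventually_analyticAt] with w hw hwa
    rw [not_lt, extMod_of_analyticAt hwa, extMod_of_analyticAt ha, enorm_le_iff_norm_le] at hw
    simpa using hw
  rw [← mem_interior_iff_mem_nhds, interior_closedBall', Metric.mem_ball, dist_zero_right] at h1
  exact lt_irrefl _ h1

/-- Open mapping theorem for the modulus: it has no local minima except zeros. -/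
theorem AnalyticAt.frequently_extMod_lt {f : ℂ → ℂ} {z : ℂ} (ha : AnalyticAt ℂ f z)
    (hc : ¬ ∀ᶠ w in 𝓝 z, f w = f z) (h0 : f z ≠ 0) :
    ∃ᶠ w in 𝓝 z, extMod f w < extMod f z := by
  have hmap := ha.eventually_constant_or_nhds_le_map_nhds.resolve_left hc
  intro hev
  have h1 : (Metric.ball (0 : ℂ) ‖f z‖)ᶜ ∈ 𝓝 (f z) := by
    apply hmap
    rw [mem_map]
    filter_upwards [hev, ha.eventually_analyticAt] with w hw hwa
    rw [not_lt, extMod_of_analyticAt hwa, extMod_of_analyticAt ha, enorm_le_iff_norm_le] at hw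
    simpa using hw
  rw [← mem_interior_iff_mem_nhds, interior_compl, closure_ball _ (norm_ne_zero_iff.2 h0),
    mem_compl_iff, Metric.mem_closedBall, dist_zero_right] at h1
  exact h1 le_rfl

/-- Near a critical point there are at least four rays on which the modulus is alternately larger
and smaller than at the critical point. -/
theorem AnalyticAt.exists_alternating_rays {f : ℂ → ℂ} {c : ℂ} (ha : AnalyticAt ℂ f c)
    (hc : ¬ ∀ᶠ w in 𝓝 c, f w = f c) (h0 : f c ≠ 0) (hd : deriv f c = 0) :
    ∃ (e : ℂ) (α ρ : ℝ), ‖e‖ = 1 ∧ 0 < α ∧ α ≤ Real.pi / 2 ∧ 0 < ρ ∧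
      ∀ s : ℝ, 0 < s → s ≤ ρ → ∀ j : ℕ,
        (Even j → ‖f c‖ < ‖f (c + s * (e * Complex.exp (α * Complex.I) ^ j))‖) ∧
        (Odd j → ‖f (c + s * (e * Complex.exp (α * Complex.I) ^ j))‖ < ‖f c‖) := by
  have haF : AnalyticAt ℂ (fun z => f z - f c) c := ha.sub analyticAt_const
  obtain ⟨n, g, hg, hg0, hfg⟩ := haF.exists_eventuallyEq_pow_smul_nonzero_iff.2 (by
    intro h; apply hc; filter_upwards [h] with w hw; exact sub_eq_zero.1 hw)
  have hn0 : n ≠ 0 := by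
    rintro rfl
    have := hfg.self_of_nhds
    simp only [sub_self, pow_zero, one_smul] at this
    exact hg0 this.symm
  have hn1 : n ≠ 1 := by
    rintro rfl
    have h1 : HasDerivAt (fun z => (z - c) ^ 1 • g z) (g c) c := by
      have h2 := ((hasDerivAt_id c).sub_const c).mul hg.differentiableAt.hasDerivAt
      have h2' : HasDerivAt (fun z => (z - c) * g z) (g c) c := by
        rw [show g c = 1 * g c + (id c - c) * deriv g c by simp]; exact h2
      simpa only [pow_one, smul_eq_mul] using h2'
    have h3 : HasDerivAt (fun z => f z - f c) (g c) c := h1.congr_of_eventuallyEq hfg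
    have h4 := h3.deriv
    rw [deriv_sub_const, hd] at h4
    exact hg0 h4.symm
  have hn2 : 2 ≤ n := by omega
  have hnR : (2 : ℝ) ≤ n := by exact_mod_cast hn2
  set κ : ℂ := g c / f c with hκ
  have hκ0 : κ ≠ 0 := div_ne_zero hg0 h0
  set m : ℝ := ‖κ‖ with hm
  have hm0 : 0 < m := norm_pos_iff.2 hκ0
  -- The direction `e` makes `e ^ n * κ` the positive number `m`, and a turn by `α = π / n` changes
  -- the sign of the `n`-th power. Along ray `j` thus `f = f c * (1 + (-1) ^ j * s ^ n * y)` with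
  -- `y` near `m`.
  set e : ℂ := Complex.exp ((-(Complex.arg κ) / n : ℝ) * Complex.I) with he
  set α : ℝ := Real.pi / n with hα
  have henorm : ‖e‖ = 1 := Complex.norm_exp_ofReal_mul_I _
  have hqnorm : ‖Complex.exp (α * Complex.I)‖ = 1 := Complex.norm_exp_ofReal_mul_I _
  have hnC : (n : ℂ) ≠ 0 := by exact_mod_cast hn0
  have hen : e ^ n * κ = m := by
    rw [he, ← Complex.exp_nat_mul]
    conv_lhs => enter [2]; rw [← Complex.norm_mul_exp_arg_mul_I κ]
    rw [mul_left_comm, ← Complex.exp_add]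
    have : (n : ℂ) * (((-(Complex.arg κ) / n : ℝ) : ℂ) * Complex.I)
        + (Complex.arg κ : ℂ) * Complex.I = 0 := by
      push_cast; field_simp; ring
    rw [this, Complex.exp_zero, mul_one]
  have hqn : Complex.exp (α * Complex.I) ^ n = -1 := by
    rw [← Complex.exp_nat_mul, hα]
    have : (n : ℂ) * (((Real.pi / n : ℝ) : ℂ) * Complex.I) = Real.pi * Complex.I := by
      push_cast; field_simp
    rw [this, Complex.exp_pi_mul_I]
  have hlim : Tendsto (fun z => e ^ n * (g z / f c)) (𝓝 c) (𝓝 (m : ℂ)) := by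
    rw [← hen]
    exact (hg.continuousAt.tendsto.div_const _).const_mul _
  have hev := (Metric.tendsto_nhds.1 hlim (m / 2) (by positivity)).and hfg
  obtain ⟨r, hr, hball⟩ := Metric.eventually_nhds_iff.1 hev
  -- The three bounds on `s` give `|y - m| < m / 2`, then `s ^ n ≤ s`, and then `s ^ n * m ≤ 1`.
  refine ⟨e, α, min (r / 2) (min 1 (1 / m)), henorm, by positivity, ?_, by positivity, ?_⟩
  · rw [hα]; gcongr
  intro s hs hsρ j
  have hs1 : s < r := by
    have := hsρ.trans (min_le_left _ _); linarith
  have hs2 : s ≤ 1 := hsρ.trans ((min_le_right _ _).trans (min_le_left _ _))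
  have hs3 : s ≤ 1 / m := hsρ.trans ((min_le_right _ _).trans (min_le_right _ _))
  have hsn : 0 < s ^ n := pow_pos hs n
  have hsm : s ^ n * m ≤ 1 := by
    have h1 : s ^ n ≤ s := pow_le_of_le_one hs.le hs2 hn0
    calc s ^ n * m ≤ s * m := by gcongr
      _ ≤ 1 / m * m := by gcongr
      _ = 1 := by field_simp
  set z := c + s * (e * Complex.exp (α * Complex.I) ^ j) with hz
  obtain ⟨h1, h2⟩ := hball (y := z) (by
    rw [dist_eq_norm, hz, add_sub_cancel_left, norm_mul, norm_mul, norm_pow, henorm, hqnorm]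
    simpa [abs_of_pos hs] using hs1)
  set y := e ^ n * (g z / f c) with hy
  rw [dist_eq_norm] at h1
  have hpow : (z - c) ^ n = s ^ n * (e ^ n * (-1) ^ j) := by
    rw [hz, add_sub_cancel_left, mul_pow, mul_pow, ← pow_mul, mul_comm j n, pow_mul, hqn]
  have hfz : f z = f c * (1 + (-1) ^ j * (s ^ n * y)) := by
    have h3 : f z = f c + (z - c) ^ n * g z := by
      rw [smul_eq_mul] at h2
      linear_combination h2
    rw [h3, hpow, hy]
    field_simp
  have hfc : 0 < ‖f c‖ := norm_pos_iff.2 h0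
  have hsy : ‖(s : ℂ) ^ n * (y - m)‖ < s ^ n * m := by
    rw [norm_mul, norm_pow, Complex.norm_real, Real.norm_eq_abs, abs_of_pos hs]
    gcongr
    linarith
  constructor
  · intro hj
    rw [hfz, hj.neg_one_pow, one_mul, norm_mul]
    refine lt_mul_of_one_lt_right hfc ?_
    have h5 : (1 + s ^ n * y : ℂ) = ((1 + s ^ n * m : ℝ) : ℂ) - -(s ^ n * (y - m)) := by
      push_cast; ring
    rw [h5]
    have h6 := norm_sub_norm_le ((1 + s ^ n * m : ℝ) : ℂ) (-((s : ℂ) ^ n * (y - m)))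
    rw [Complex.norm_real, Real.norm_eq_abs, abs_of_pos (by positivity), norm_neg] at h6
    linarith
  · intro hj
    rw [hfz, hj.neg_one_pow, norm_mul]
    refine mul_lt_of_lt_one_right hfc ?_
    have h5 : (1 + -1 * (s ^ n * y) : ℂ) = ((1 - s ^ n * m : ℝ) : ℂ) - (s ^ n * (y - m)) := by
      push_cast; ring
    rw [h5]
    have h6 := norm_sub_le ((1 - s ^ n * m : ℝ) : ℂ) ((s : ℂ) ^ n * (y - m))
    rw [Complex.norm_real, Real.norm_eq_abs, abs_of_nonneg (by linarith)] at h6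
    linarith

/-! ### Level curves in `G`, and finiteness of zeros and poles -/

theorem isClosed_connectedComponentIn_of_isClosed {X : Type*} [TopologicalSpace X] {F : Set X}
    (hF : IsClosed F) (x : X) : IsClosed (connectedComponentIn F x) := by
  by_cases hx : x ∈ F
  · rw [connectedComponentIn_eq_image hx]
    exact hF.isClosedEmbedding_subtypeVal.isClosedMap _ isClosed_connectedComponent
  · rw [connectedComponentIn_eq_empty hx]; exact isClosed_empty

theorem extMod_eq_of_mem_levelCurve {f : ℂ → ℂ} {U : Set ℂ} {z w : ℂ} (hw : w ∈ levelCurve f U z) :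
    extMod f w = extMod f z :=
  (connectedComponentIn_subset _ _ hw).2

theorem levelCurve_eq_of_mem {f : ℂ → ℂ} {U : Set ℂ} {z w : ℂ} (hw : w ∈ levelCurve f U z) :
    levelCurve f U w = levelCurve f U z := by
  rw [levelCurve, extMod_eq_of_mem_levelCurve hw]
  exact (connectedComponentIn_eq hw).symm

theorem disjoint_levelCurve {f : ℂ → ℂ} {U : Set ℂ} {z w : ℂ} (h :
    levelCurve f U z ≠ levelCurve f U w) :
    Disjoint (levelCurve f U z) (levelCurve f U w) := by
  rw [Set.disjoint_left]
  intro x hx hx'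
  exact h ((levelCurve_eq_of_mem hx).symm.trans (levelCurve_eq_of_mem hx'))

namespace LevelCurveSetting

variable {f : ℂ → ℂ} {U G : Set ℂ}

theorem nfAt (hS : LevelCurveSetting f U G) {z : ℂ} (hz : z ∈ closure G) : MeromorphicNFAt f z :=
  hS.meromorphic (hS.closure_subset hz)

theorem continuousAt_extMod (hS : LevelCurveSetting f U G) {z : ℂ} (hz : z ∈ closure G) :
    ContinuousAt (extMod f) z :=
  (hS.nfAt hz).continuousAt_extMod

theorem isClosed_level (hS : LevelCurveSetting f U G) (t : ℝ≥0∞) :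
    IsClosed (closure G ∩ extMod f ⁻¹' {t}) :=
  ContinuousOn.preimage_isClosed_of_isClosed
    (fun _ hz => (hS.continuousAt_extMod hz).continuousWithinAt) isClosed_closure isClosed_singleton

theorem mem_dom (hS : LevelCurveSetting f U G) {z : ℂ} (hz : z ∈ G) : z ∈ U :=
    hS.closure_subset (subset_closure hz)

theorem mem_levelSet (hS : LevelCurveSetting f U G) {z : ℂ} (hz : z ∈ G) :
    z ∈ levelSet f U (extMod f z) := ⟨hS.mem_dom hz, rfl⟩

theorem mem_levelCurve (hS : LevelCurveSetting f U G) {z : ℂ} (hz : z ∈ G) : z ∈ levelCurve f U z :=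
  mem_connectedComponentIn (hS.mem_levelSet hz)

theorem levelCurve_subset (hS : LevelCurveSetting f U G) {z : ℂ} (hz : z ∈ G) :
    levelCurve f U z ⊆ G :=
  subset_closure.trans (hS.closure_curve_subset z hz)

theorem isConnected_levelCurve (hS : LevelCurveSetting f U G) {z : ℂ} (hz : z ∈ G) :
    IsConnected (levelCurve f U z) :=
  isConnected_connectedComponentIn_iff.2 (hS.mem_levelSet hz)

theorem isLevelCurveIn_levelCurve (hS : LevelCurveSetting f U G) {z : ℂ} (hz : z ∈ G) :
    IsLevelCurveIn f U G (levelCurve f U z) :=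
  ⟨⟨extMod f z, z, hS.mem_levelSet hz, rfl⟩, hS.levelCurve_subset hz⟩

/-- The level set in `U` need not be closed in the plane, but its part in `closure G` is. This is
the source of compactness and of isolating neighbourhoods. -/
theorem levelCurve_eq_connectedComponentIn (hS : LevelCurveSetting f U G) {z : ℂ} (hz : z ∈ G) :
    levelCurve f U z = connectedComponentIn (closure G ∩ extMod f ⁻¹' {extMod f z}) z := by
  apply Subset.antisymm
  · refine (hS.isConnected_levelCurve hz).isPreconnected.subset_connectedComponentIn
      (hS.mem_levelCurve hz) fun w hw => ⟨subset_closure (hS.levelCurve_subset hz hw), ?_⟩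
    exact extMod_eq_of_mem_levelCurve hw
  · exact connectedComponentIn_mono z fun w hw => ⟨hS.closure_subset hw.1, hw.2⟩

theorem isCompact_levelCurve (hS : LevelCurveSetting f U G) {z : ℂ} (hz : z ∈ G) :
    IsCompact (levelCurve f U z) := by
  refine Metric.isCompact_of_isClosed_isBounded ?_
    (hS.bounded_curves _ (hS.isLevelCurveIn_levelCurve hz))
  rw [hS.levelCurve_eq_connectedComponentIn hz]
  exact isClosed_connectedComponentIn_of_isClosed (hS.isClosed_level _) _

/-- Otherwise `G` would lie in one level curve. The closure of that curve is in `G`, so `G` would be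
clopen, hence the whole plane, although level curves in `G` are bounded. -/
theorem not_forall_extMod_eq (hS : LevelCurveSetting f U G) (t : ℝ≥0∞) :
    ¬ ∀ z ∈ G, extMod f z = t := by
  intro h
  obtain ⟨z, hz⟩ := hS.connected.nonempty
  have h1 : G ⊆ levelCurve f U z :=
    hS.connected.isPreconnected.subset_connectedComponentIn hz fun w hw =>
      ⟨hS.mem_dom hw, (h w hw).trans (h z hz).symm⟩
  have h2 : IsClosed G := by
    rw [← closure_subset_iff_isClosed]
    exact (closure_mono h1).trans (hS.closure_curve_subset z hz)
  have h3 : G = univ := IsClopen.eq_univ ⟨h2, hS.isOpen⟩ ⟨z, hz⟩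
  have h4 := (hS.isCompact_levelCurve hz).isBounded
  exact NormedSpace.unbounded_univ ℝ ℂ (h4.subset (h3 ▸ h1))

/-- The identity theorem spreads the constant over the punctured neighbourhoods of all points of
`G`, and normal form removes the punctures. -/
theorem not_eventually_eq_const (hS : LevelCurveSetting f U G) {z : ℂ} (hz : z ∈ G) (c : ℂ) :
    ¬ ∀ᶠ w in 𝓝[≠] z, f w = c := by
  intro h
  apply hS.not_forall_extMod_eq ‖c‖ₑ
  have hm : MeromorphicOn (fun w => f w - c) G := fun w hw =>
    (hS.nfAt (subset_closure hw)).meromorphicAt.sub (MeromorphicAt.const c w)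
  intro w hw
  have htop : meromorphicOrderAt (fun w => f w - c) w = ⊤ := by
    by_contra hne
    refine hm.meromorphicOrderAt_ne_top_of_isPreconnected hS.connected.isPreconnected hw hz hne ?_
    rw [meromorphicOrderAt_eq_top_iff]
    filter_upwards [h] with x hx
    rw [hx, sub_self]
  rw [meromorphicOrderAt_eq_top_iff] at htop
  have h1 : f =ᶠ[𝓝[≠] w] fun _ => c := by
    filter_upwards [htop] with x hx
    exact sub_eq_zero.1 hx
  have h2 : f =ᶠ[𝓝 w] fun _ => c :=
    (MeromorphicNFAt.eventuallyEq_nhdsNE_iff_eventuallyEq_nhds (hS.nfAt (subset_closure hw))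
      (analyticAt_const.meromorphicNFAt)).1 h1
  rw [extMod_of_analyticAt ((analyticAt_congr h2).2 analyticAt_const), h2.self_of_nhds]

theorem analyticAt (hS : LevelCurveSetting f U G) {z : ℂ} (hz : z ∈ G) (ht : extMod f z ≠ ⊤) :
    AnalyticAt ℂ f z :=
  (hS.nfAt (subset_closure hz)).analyticAt_of_extMod_ne_top ht

theorem not_eventually_eq (hS : LevelCurveSetting f U G) {z : ℂ} (hz : z ∈ G) :
    ¬ ∀ᶠ w in 𝓝 z, f w = f z := fun h =>
  hS.not_eventually_eq_const hz _ (h.filter_mono nhdsWithin_le_nhds)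

theorem frequently_lt_extMod (hS : LevelCurveSetting f U G) {z : ℂ} (hz : z ∈ G) (ht :
    extMod f z ≠ ⊤) :
    ∃ᶠ w in 𝓝 z, extMod f z < extMod f w :=
  (hS.analyticAt hz ht).frequently_lt_extMod (hS.not_eventually_eq hz)

theorem frequently_extMod_lt (hS : LevelCurveSetting f U G) {z : ℂ} (hz : z ∈ G) (ht :
    extMod f z ≠ ⊤) (h0 : extMod f z ≠ 0) :
    ∃ᶠ w in 𝓝 z, extMod f w < extMod f z :=
  (hS.analyticAt hz ht).frequently_extMod_lt (hS.not_eventually_eq hz) fun h => h0 (by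
    rw [extMod_of_analyticAt (hS.analyticAt hz ht), h, enorm_zero])

/-- Boundary points are included: if `f` vanished on a punctured neighbourhood of `b`, it would
vanish near some point of `G`. -/
theorem eventually_regular (hS : LevelCurveSetting f U G) {b : ℂ} (hb : b ∈ closure G) :
    ∀ᶠ w in 𝓝[≠] b, extMod f w ≠ 0 ∧ extMod f w ≠ ⊤ := by
  have hm := (hS.nfAt hb).meromorphicAt
  rcases hm.eventually_eq_zero_or_eventually_ne_zero with h | h
  · exfalso
    obtain ⟨O, hO, hbO, hOs⟩ := mem_nhdsWithin.1 h
    have hne : ((O ∩ G) \ {b}).Nonempty := by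
      obtain ⟨y, hyO, hyG⟩ := mem_closure_iff.1 hb O hO hbO
      by_cases hyb : y = b
      · subst hyb
        have : (O ∩ G) ∈ 𝓝 y := (hO.inter hS.isOpen).mem_nhds ⟨hyO, hyG⟩
        have h2 : (O ∩ G) \ {y} ∈ 𝓝[≠] y := sdiff_mem_nhdsWithin_compl this _
        exact Filter.nonempty_of_mem h2
      · exact ⟨y, ⟨hyO, hyG⟩, hyb⟩
    obtain ⟨y, ⟨hyO, hyG⟩, hyb⟩ := hne
    refine hS.not_eventually_eq_const hyG 0 ?_
    have : O \ {b} ∈ 𝓝 y := (hO.sdiff isClosed_singleton).mem_nhds ⟨hyO, hyb⟩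
    filter_upwards [mem_nhdsWithin_of_mem_nhds this] with w hw
    exact hOs ⟨hw.1, hw.2⟩
  · filter_upwards [h, hm.eventually_analyticAt] with w hw hwa
    refine ⟨?_, extMod_ne_top_of_analyticAt hwa⟩
    rw [extMod_of_analyticAt hwa]
    simpa using hw

theorem finite_zeros_poles (hS : LevelCurveSetting f U G) :
    {z ∈ G | extMod f z = 0 ∨ extMod f z = ⊤}.Finite := by
  set Z := {z ∈ G | extMod f z = 0 ∨ extMod f z = ⊤} with hZ
  have hb : Bornology.IsBounded Z := by
    by_cases hG : Bornology.IsBounded G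
    · exact hG.subset fun z hz => hz.1
    · have h1 := hS.tendsto_infinity hG
      have h2 : ∀ᶠ x in 𝓝 (1 : ℝ≥0∞), x ≠ 0 ∧ x ≠ ⊤ :=
        (isOpen_ne.eventually_mem one_ne_zero).and (isOpen_ne.eventually_mem ENNReal.one_ne_top)
      have h3 := h1.eventually h2
      rw [eventually_inf_principal] at h3
      rw [← Bornology.isCobounded_compl_iff, Bornology.isCobounded_def]
      filter_upwards [h3] with w hw hwZ
      rcases hwZ.2 with h | h
      · exact (hw hwZ.1).1 h
      · exact (hw hwZ.1).2 h
  by_contra hinf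
  obtain ⟨R, hR⟩ := hb.subset_closedBall 0
  obtain ⟨b, hb, hacc⟩ := (show Z.Infinite from hinf).exists_accPt_of_subset_isCompact
    ((isCompact_closedBall (0 : ℂ) R).inter_right isClosed_closure)
    (subset_inter hR fun z hz => subset_closure hz.1)
  rw [accPt_iff_frequently_nhdsNE] at hacc
  exact hacc ((hS.eventually_regular hb.2).mono fun w hw hwZ =>
    hwZ.2.elim hw.1 hw.2)

end LevelCurveSetting

/-! ### Thickenings and outer faces -/

theorem outerFace_anti {M M' : Set ℂ} (h : M ⊆ M') : outerFace M' ⊆ outerFace M := fun _ hz =>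
  ⟨fun hM => hz.1 (h hM), fun hb => hz.2
    (hb.subset (connectedComponentIn_mono _ (compl_subset_compl.2 h)))⟩

/-- A path in the outer face from `q` to a far point is compact, so it keeps a positive distance
from `M`. -/
theorem exists_mem_outerFace_cthickening {M : Set ℂ} (hM : IsCompact M) {q : ℂ}
    (hq : q ∈ outerFace M) : ∃ ε > 0, q ∈ outerFace (Metric.cthickening ε M) := by
  obtain ⟨R, hR⟩ := (hM.isBounded.cthickening (δ := 1)).subset_closedBall 0
  obtain ⟨p, hp, hpR⟩ := exists_norm_gt_notMem (not_isBounded_outerFace hM.isBounded) R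
  have hpc : IsPathConnected (outerFace M) :=
    ((isOpen_outerFace hM.isClosed).isConnected_iff_isPathConnected).1
      ⟨⟨q, hq⟩, isPreconnected_outerFace hM.isBounded⟩
  obtain ⟨γ, hγ⟩ := hpc.joinedIn q hq p hp
  have hγk : IsCompact (range γ) := isCompact_range γ.continuous
  obtain ⟨ε, hε, hεs⟩ := hM.exists_cthickening_subset_open hγk.isClosed.isOpen_compl (by
    rintro m hm ⟨t, rfl⟩
    exact (hγ t).1 hm)
  refine ⟨min ε 1, by positivity, ?_⟩
  have h1 : Metric.cthickening (min ε 1) M ⊆ Metric.closedBall 0 R :=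
    (Metric.cthickening_mono (min_le_right _ _) M).trans hR
  refine (isPreconnected_range γ.continuous).subset_outerFace ?_
    ⟨p, ⟨1, γ.target⟩, compl_closedBall_subset_outerFace h1 (by simpa using hpR)⟩ ⟨0, γ.source⟩
  exact subset_compl_comm.1 ((Metric.cthickening_mono (min_le_left _ _) M).trans hεs)

theorem exists_subset_outerFace_cthickening {M T : Set ℂ} (hM : IsCompact M) (hT : IsCompact T)
    (h : T ⊆ outerFace M) : ∃ ε > 0, T ⊆ outerFace (Metric.cthickening ε M) := by
  refine hT.induction_on (p := fun T => ∃ ε > 0, T ⊆ outerFace (Metric.cthickening ε M))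
    ⟨1, one_pos, empty_subset _⟩ ?_ ?_ ?_
  · rintro s t hst ⟨ε, hε, ht⟩; exact ⟨ε, hε, hst.trans ht⟩
  · rintro s t ⟨ε, hε, hs⟩ ⟨ε', hε', ht⟩
    refine ⟨min ε ε', lt_min hε hε', union_subset (hs.trans ?_) (ht.trans ?_)⟩
    · exact outerFace_anti (Metric.cthickening_mono (min_le_left _ _) M)
    · exact outerFace_anti (Metric.cthickening_mono (min_le_right _ _) M)
  · intro x hx
    obtain ⟨ε, hε, hxε⟩ := exists_mem_outerFace_cthickening hM (h hx)
    exact ⟨_, mem_nhdsWithin_of_mem_nhds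
      ((isOpen_outerFace Metric.isClosed_cthickening).mem_nhds hxε), ε, hε, Subset.rfl⟩

theorem IsPreconnected.union_thickening {S T : Set ℂ} (hS : IsPreconnected S)
    (hT : T ⊆ closure S) {δ : ℝ} (hδ : 0 < δ) : IsPreconnected (S ∪ Metric.thickening δ T) := by
  rcases S.eq_empty_or_nonempty with rfl | ⟨s, hs⟩
  · rw [closure_empty, subset_empty_iff] at hT
    simpa [hT] using isPreconnected_empty
  refine isPreconnected_of_forall s fun y hy => ?_
  rcases hy with hy | hy
  · exact ⟨S, subset_union_left, hs, hy, hS⟩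
  · obtain ⟨x, hx, hyx⟩ := Metric.mem_thickening_iff.1 hy
    obtain ⟨w, hw, hwS⟩ := mem_closure_iff.1 (hT hx) (Metric.ball x δ) Metric.isOpen_ball
      (Metric.mem_ball_self hδ)
    refine ⟨S ∪ Metric.ball x δ, union_subset_union_right _ ?_, Or.inl hs, Or.inr hyx,
      hS.union w hwS hw Metric.isPreconnected_ball⟩
    intro v hv
    exact Metric.mem_thickening_iff.2 ⟨x, hx, hv⟩

/-- The boundary of a compact connected set with connected complement is not the disjoint union of
two nonempty closed sets. -/
theorem not_frontier_eq_union {Y A B : Set ℂ} (hY : IsClosed Y) (hYc : IsPreconnected Y)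
    (hYc' : IsPreconnected Yᶜ) (hA : IsCompact A) (hB : IsCompact B) (hAB : Disjoint A B)
    (hfr : frontier Y = A ∪ B) (hAne : A.Nonempty) (hBne : B.Nonempty) : False := by
  obtain ⟨δ, hδ, hd⟩ := hAB.exists_thickenings hA hB.isClosed
  have hth : Metric.thickening δ (frontier Y) = Metric.thickening δ A ∪ Metric.thickening δ B := by
    rw [hfr, Metric.thickening_union]
  have hO : IsOpen (Metric.thickening δ (frontier Y)) := Metric.isOpen_thickening
  have h1 : IsPreconnected (Y ∪ Metric.thickening δ (frontier Y)) :=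
    hYc.union_thickening frontier_subset_closure hδ
  have h2 : IsPreconnected (Yᶜ ∪ Metric.thickening δ (frontier Y)) :=
    hYc'.union_thickening (by rw [← frontier_compl]; exact frontier_subset_closure) hδ
  have h3 : Y ∪ Metric.thickening δ (frontier Y) = interior Y ∪
      Metric.thickening δ (frontier Y) := by
    apply Subset.antisymm
    · rintro y (hy | hy)
      · by_cases h : y ∈ interior Y
        · exact Or.inl h
        · exact Or.inr (Metric.self_subset_thickening hδ _ ⟨subset_closure hy, h⟩)
      · exact Or.inr hy
    · exact union_subset_union_left _ interior_subset
  -- By unicoherence the intersection is connected, yet it is the union of the disjoint thickenings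
  -- of `A` and `B`.
  have h4 := isPreconnected_inter_of_union_eq_univ (h3 ▸ isOpen_interior.union hO)
    (hY.isOpen_compl.union hO) h1 h2 (by
      ext z; by_cases hz : z ∈ Y <;> simp [hz])
  have h5 : (Y ∪ Metric.thickening δ (frontier Y)) ∩ (Yᶜ ∪ Metric.thickening δ (frontier Y))
      = Metric.thickening δ A ∪ Metric.thickening δ B := by
    rw [← hth, ← inter_union_distrib_right, inter_compl_self, empty_union]
  rw [h5] at h4
  obtain ⟨x, -, hx⟩ := h4 _ _ Metric.isOpen_thickening Metric.isOpen_thickening Subset.rfl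
    (hAne.imp fun a ha => ⟨Or.inl (Metric.self_subset_thickening hδ _ ha),
      Metric.self_subset_thickening hδ _ ha⟩)
    (hBne.imp fun a ha => ⟨Or.inr (Metric.self_subset_thickening hδ _ ha),
      Metric.self_subset_thickening hδ _ ha⟩)
  exact Set.disjoint_left.1 hd hx.1 hx.2

/-! ### Obstacles and bounded faces of level curves -/

/-- The points of `G` that are neither zeros nor poles. -/
def regularSet (f : ℂ → ℂ) (G : Set ℂ) : Set ℂ := {z ∈ G | extMod f z ≠ 0 ∧ extMod f z ≠ ⊤}

/-- The bounded components of the complement of `G`, and the zeros and poles in `G`. -/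
def obstacles (f : ℂ → ℂ) (G : Set ℂ) : Set (Set ℂ) :=
  {C | IsComponentOf Gᶜ C ∧ Bornology.IsBounded C} ∪
    (fun z => {z}) '' {z ∈ G | extMod f z = 0 ∨ extMod f z = ⊤}

/-- The obstacles surrounded by `M`. -/
def enclosedObstacles (f : ℂ → ℂ) (G M : Set ℂ) : Set (Set ℂ) := {o ∈ obstacles f G | o ⊆ filled M}

theorem isConnected_of_mem_obstacles {f : ℂ → ℂ} {G o : Set ℂ} (ho : o ∈ obstacles f G) :
    IsConnected o := by
  rcases ho with ⟨⟨x, hx, rfl⟩, -⟩ | ⟨z, -, rfl⟩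
  · exact isConnected_connectedComponentIn_iff.2 hx
  · exact isConnected_singleton

/-- A non-regular point is either a zero or pole in `G`, or lies in a component of `Gᶜ` which `M ⊆
G` cannot cut, so that this component stays in one bounded face. -/
theorem exists_mem_obstacles {f : ℂ → ℂ} {G M : Set ℂ} (hM : M ⊆ regularSet f G) {x : ℂ}
    (hx : x ∈ enclosed M) (hxR : x ∉ regularSet f G) :
    ∃ o ∈ obstacles f G, x ∈ o ∧ o ⊆ connectedComponentIn Mᶜ x := by
  by_cases hxG : x ∈ G
  · refine ⟨{x}, Or.inr ⟨x, ⟨hxG, ?_⟩, rfl⟩, rfl, ?_⟩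
    · by_contra h
      exact hxR ⟨hxG, not_or.1 h⟩
    · rintro _ rfl
      exact mem_connectedComponentIn hx.2
  · have hsub : connectedComponentIn Gᶜ x ⊆ connectedComponentIn Mᶜ x :=
      connectedComponentIn_mono x (compl_subset_compl.2 fun m hm => (hM hm).1)
    exact ⟨connectedComponentIn Gᶜ x, Or.inl ⟨⟨x, hxG, rfl⟩, (mem_enclosed.1 hx).2.subset hsub⟩,
      mem_connectedComponentIn hxG, hsub⟩

namespace LevelCurveSetting

variable {f : ℂ → ℂ} {U G : Set ℂ}

theorem finite_obstacles (hS : LevelCurveSetting f U G) : (obstacles f G).Finite :=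
  hS.finite_holes.union (hS.finite_zeros_poles.image _)

theorem isOpen_regularSet (hS : LevelCurveSetting f U G) : IsOpen (regularSet f G) := by
  have : regularSet f G = G \ {z ∈ G | extMod f z = 0 ∨ extMod f z = ⊤} := by
    ext z
    simp only [regularSet, mem_ofPred_eq, Set.mem_sdiff]
    tauto
  rw [this]
  exact hS.isOpen.sdiff hS.finite_zeros_poles.isClosed

theorem levelCurve_subset_regularSet (hS : LevelCurveSetting f U G) {z : ℂ}
    (hz : z ∈ regularSet f G) : levelCurve f U z ⊆ regularSet f G := fun w hw => by
  refine ⟨hS.levelCurve_subset hz.1 hw, ?_⟩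
  rw [extMod_eq_of_mem_levelCurve hw]
  exact hz.2

theorem le_extMod_of_frontier (hS : LevelCurveSetting f U G) {R : Set ℂ}
    (hb : Bornology.IsBounded R) (hR : closure R ⊆ regularSet f G) {t : ℝ≥0∞}
    (ht : ∀ z ∈ frontier R, t ≤ extMod f z) : ∀ z ∈ closure R, t ≤ extMod f z :=
  le_extMod_of_forall_frontier hb (fun _ hz => hS.analyticAt (hR hz).1 (hR hz).2.2)
    (fun _ hz => (hR hz).2.1) ht

theorem extMod_le_of_frontier (hS : LevelCurveSetting f U G) {R : Set ℂ}
    (hb : Bornology.IsBounded R) (hR : closure R ⊆ regularSet f G) {t : ℝ≥0∞}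
    (ht : ∀ z ∈ frontier R, extMod f z ≤ t) : ∀ z ∈ closure R, extMod f z ≤ t :=
  extMod_le_of_forall_frontier hb (fun _ hz => hS.analyticAt (hR hz).1 (hR hz).2.2) ht

/-- Equality at an interior point would be a local minimum, which the open mapping theorem excludes
away from zeros. -/
theorem lt_extMod_of_frontier (hS : LevelCurveSetting f U G) {R : Set ℂ}
    (hb : Bornology.IsBounded R) (hR : closure R ⊆ regularSet f G) {t : ℝ≥0∞}
    (ht : ∀ z ∈ frontier R, t ≤ extMod f z) : ∀ z ∈ interior R, t < extMod f z := by
  intro z hz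
  have hle := hS.le_extMod_of_frontier hb hR ht
  have hzc : z ∈ closure R := subset_closure (interior_subset hz)
  refine (hle z hzc).lt_of_ne fun h => ?_
  obtain ⟨w, hw, hwR⟩ := ((hS.frequently_extMod_lt (hR hzc).1 (hR hzc).2.2
    (hR hzc).2.1).and_eventually (isOpen_interior.mem_nhds hz)).exists
  exact absurd (hle w (subset_closure (interior_subset hwR))) (not_le.2 (h ▸ hw))

theorem extMod_lt_of_frontier (hS : LevelCurveSetting f U G) {R : Set ℂ}
    (hb : Bornology.IsBounded R) (hR : closure R ⊆ regularSet f G) {t : ℝ≥0∞}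
    (ht : ∀ z ∈ frontier R, extMod f z ≤ t) : ∀ z ∈ interior R, extMod f z < t := by
  intro z hz
  have hle := hS.extMod_le_of_frontier hb hR ht
  have hzc : z ∈ closure R := subset_closure (interior_subset hz)
  refine (hle z hzc).lt_of_ne fun h => ?_
  obtain ⟨w, hw, hwR⟩ := ((hS.frequently_lt_extMod (hR hzc).1 (hR hzc).2.2).and_eventually
    (isOpen_interior.mem_nhds hz)).exists
  exact absurd (hle w (subset_closure (interior_subset hwR))) (not_le.2 (h ▸ hw))

/-- A level curve of a regular point has a bounded face. -/
theorem enclosed_nonempty (hS : LevelCurveSetting f U G) {z : ℂ} (hz : z ∈ regularSet f G) :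
    (enclosed (levelCurve f U z)).Nonempty := by
  by_contra hempty
  rw [not_nonempty_iff_eq_empty] at hempty
  set M := levelCurve f U z with hM
  set t := extMod f z with ht
  set X := closure G ∩ extMod f ⁻¹' {t} with hX
  have hMX : M = connectedComponentIn X z := hS.levelCurve_eq_connectedComponentIn hz.1
  have hMk : IsCompact M := hS.isCompact_levelCurve hz.1
  have hMc : IsConnected M := hS.isConnected_levelCurve hz.1
  have hzM : z ∈ M := hS.mem_levelCurve hz.1
  have hzX : z ∈ X := ⟨subset_closure hz.1, rfl⟩
  have hMR := hS.levelCurve_subset_regularSet hz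
  have hXc : IsClosed X := hS.isClosed_level t
  have hiso : ∀ O, IsOpen O → M ⊆ O → ∃ N, IsOpen N ∧ M ⊆ N ∧ IsCompact (closure N) ∧
      closure N ⊆ O ∧ Disjoint (frontier N) X := fun O hO hMO => by
    have := exists_isolating_nhds hXc hzX (hMX ▸ hMk) hO (hMX ▸ hMO)
    rwa [← hMX] at this
  obtain ⟨N₀, hN₀, hMN₀, hN₀k, hN₀R, -⟩ := hiso _ hS.isOpen_regularSet hMR
  have hfrN₀ : frontier N₀ ⊆ outerFace M := by
    intro w hw
    by_contra h
    rcases mem_filled_cases (show w ∈ filled M from h) with h | h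
    · rw [hN₀.frontier_eq] at hw; exact hw.2 (hMN₀ h)
    · rw [hempty] at h; exact h
  obtain ⟨ε, hε, hfrε⟩ := exists_subset_outerFace_cthickening hMk
    (hN₀k.of_isClosed_subset isClosed_frontier frontier_subset_closure) hfrN₀
  obtain ⟨N₁, hN₁, hMN₁, hN₁k, hN₁ε, hN₁X⟩ := hiso _ Metric.isOpen_thickening
    (Metric.self_subset_thickening hε M)
  set N := connectedComponentIn N₁ z with hN
  have hMN : M ⊆ N := hMc.isPreconnected.subset_connectedComponentIn hzM hMN₁
  have hNo : IsOpen N := hN₁.connectedComponentIn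
  have hclN : closure N ⊆ closure N₁ := closure_mono (connectedComponentIn_subset _ _)
  have hfrN : frontier N ⊆ frontier N₁ := fun w hw => by
    rw [hN₁.frontier_eq]
    exact ⟨hclN (frontier_subset_closure hw), frontier_connectedComponentIn_subset hN₁ z hw⟩
  have hNc : IsConnected (closure N) :=
    (isConnected_connectedComponentIn_iff.2 (hMN₁ hzM)).closure
  have hNk : IsCompact (closure N) := hN₁k.of_isClosed_subset isClosed_closure hclN
  -- If `M` had no bounded face, filling a thin neighbourhood of it would bring in no obstacle. On
  -- the frontier of this `Y` the modulus avoids `t`, so the frontier splits into the parts below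
  -- and above `t`. Both are nonempty by the extremum principles, since `t` is attained at the
  -- interior point `z`.
  set Y := filled (closure N) with hY
  have hYk : IsCompact Y := isCompact_filled hNk
  have hYc : IsPreconnected Y := isPreconnected_filled isClosed_closure hNc
  have hNY : N ⊆ Y := subset_closure.trans subset_filled
  have hYN₀ : Y ⊆ N₀ := by
    refine hYc.subset_of_disjoint_frontier ⟨z, hNY (hMN hzM), hMN₀ hzM⟩ ?_
    rw [Set.disjoint_left]
    intro w hwY hw
    exact hwY (outerFace_anti ((hclN.trans hN₁ε).trans
      (Metric.thickening_subset_cthickening ε M)) (hfrε hw))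
  have hYR : Y ⊆ regularSet f G := (hYN₀.trans subset_closure).trans hN₀R
  have hclY : closure Y ⊆ regularSet f G := by rwa [hYk.isClosed.closure_eq]
  have hYcc : Yᶜ = outerFace (closure N) := compl_compl _
  have hfrY : ∀ w ∈ frontier Y, extMod f w ≠ t := by
    intro w hw hwt
    have hwY : w ∈ Y := hYk.isClosed.frontier_subset hw
    have hwN : w ∉ N := fun h =>
      hw.2 (interior_maximal hNY hNo h)
    have hwcl : w ∈ closure N := by
      obtain ⟨p, hp⟩ := outerFace_nonempty hNk.isBounded
      rw [← frontier_compl, hYcc, outerFace_eq_connectedComponentIn hNk.isBounded hp] at hw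
      exact not_not.1 (frontier_connectedComponentIn_subset isClosed_closure.isOpen_compl p hw)
    have hwfr : w ∈ frontier N := by rw [hNo.frontier_eq]; exact ⟨hwcl, hwN⟩
    exact Set.disjoint_left.1 hN₁X (hfrN hwfr) ⟨subset_closure (hYR hwY).1, hwt⟩
  have hzY : z ∈ interior Y := interior_maximal hNY hNo (hMN hzM)
  have hcont : ContinuousOn (extMod f) (frontier Y) := fun w hw =>
    (hS.continuousAt_extMod (subset_closure
      (hYR (hYk.isClosed.frontier_subset hw)).1)).continuousWithinAt
  have hfrk : IsCompact (frontier Y) :=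
    hYk.of_isClosed_subset isClosed_frontier hYk.isClosed.frontier_subset
  set A := frontier Y ∩ extMod f ⁻¹' Iic t with hA
  set B := frontier Y ∩ extMod f ⁻¹' Ici t with hB
  have hAk : IsCompact A := hfrk.of_isClosed_subset
    (hcont.preimage_isClosed_of_isClosed isClosed_frontier isClosed_Iic) inter_subset_left
  have hBk : IsCompact B := hfrk.of_isClosed_subset
    (hcont.preimage_isClosed_of_isClosed isClosed_frontier isClosed_Ici) inter_subset_left
  refine not_frontier_eq_union hYk.isClosed hYc
    (hYcc ▸ isPreconnected_outerFace hNk.isBounded) hAk hBk ?_ ?_ ?_ ?_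
  · rw [Set.disjoint_left]
    intro w hw hw'
    exact hfrY w hw.1 (le_antisymm hw.2 hw'.2)
  · rw [hA, hB, ← inter_union_distrib_left, ← preimage_union, Iic_union_Ici, preimage_univ,
      inter_univ]
  · by_contra h
    rw [not_nonempty_iff_eq_empty] at h
    refine lt_irrefl t (hS.lt_extMod_of_frontier hYk.isBounded hclY (t := t) (fun w hw => ?_) z hzY)
    by_contra h'
    have : w ∈ A := ⟨hw, (not_le.1 h').le⟩
    rw [h] at this; exact this
  · by_contra h
    rw [not_nonempty_iff_eq_empty] at h
    refine lt_irrefl t (hS.extMod_lt_of_frontier hYk.isBounded hclY (t := t) (fun w hw => ?_) z hzY)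
    by_contra h'
    have : w ∈ B := ⟨hw, (not_le.1 h').le⟩
    rw [h] at this; exact this

end LevelCurveSetting

namespace LevelCurveSetting

variable {f : ℂ → ℂ} {U G : Set ℂ}

/-- Every bounded face of a level curve contains an obstacle. -/
theorem exists_obstacle_subset_face (hS : LevelCurveSetting f U G) {z : ℂ}
    (hz : z ∈ regularSet f G) {x : ℂ} (hx : x ∈ enclosed (levelCurve f U z)) :
    ∃ o ∈ obstacles f G, o ⊆ connectedComponentIn (levelCurve f U z)ᶜ x := by
  by_contra hno
  set M := levelCurve f U z with hM
  set V := connectedComponentIn Mᶜ x with hV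
  have hMk : IsCompact M := hS.isCompact_levelCurve hz.1
  have hMR := hS.levelCurve_subset_regularSet hz
  have hVe : V ⊆ enclosed M := connectedComponentIn_subset_enclosed hx
  have hVR : V ⊆ regularSet f G := by
    intro y hy
    by_contra hyR
    obtain ⟨o, ho, -, hoV⟩ := exists_mem_obstacles hMR (hVe hy) hyR
    exact hno ⟨o, ho, by rwa [hV, connectedComponentIn_eq hy]⟩
  have hVo : IsOpen V := hMk.isClosed.isOpen_compl.connectedComponentIn
  have hfr : frontier V ⊆ M := fun w hw =>
    not_not.1 (frontier_connectedComponentIn_subset hMk.isClosed.isOpen_compl x hw)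
  have hVb : Bornology.IsBounded V := (mem_enclosed.1 hx).2
  have hcl : closure V ⊆ regularSet f G := by
    rw [closure_eq_self_union_frontier]
    exact union_subset hVR (hfr.trans hMR)
  have hxV : x ∈ interior V := by
    rw [hVo.interior_eq]; exact mem_connectedComponentIn hx.2
  have h1 := hS.lt_extMod_of_frontier hVb hcl (t := extMod f z)
    (fun w hw => (extMod_eq_of_mem_levelCurve (hfr hw)).ge) x hxV
  have h2 := hS.extMod_lt_of_frontier hVb hcl (t := extMod f z)
    (fun w hw => (extMod_eq_of_mem_levelCurve (hfr hw)).le) x hxV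
  exact lt_asymm h1 h2

theorem enclosedObstacles_nonempty (hS : LevelCurveSetting f U G) {z : ℂ}
    (hz : z ∈ regularSet f G) : (enclosedObstacles f G (levelCurve f U z)).Nonempty := by
  obtain ⟨x, hx⟩ := hS.enclosed_nonempty hz
  obtain ⟨o, ho, hox⟩ := hS.exists_obstacle_subset_face hz hx
  exact ⟨o, ho, hox.trans ((connectedComponentIn_subset_enclosed hx).trans enclosed_subset_filled)⟩

/-! ### Nested curves surrounding the same obstacles -/

section Nested

variable {z z' : ℂ}

/-- Level curves surrounding the same obstacles are nested. -/
theorem nested_of_enclosedObstacles_eq (hS : LevelCurveSetting f U G)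
    (hz : z ∈ regularSet f G) (hz' : z' ∈ regularSet f G)
    (hne : levelCurve f U z ≠ levelCurve f U z')
    (hobs : enclosedObstacles f G (levelCurve f U z') = enclosedObstacles f G (levelCurve f U z)) :
    filled (levelCurve f U z') ⊆ enclosed (levelCurve f U z) ∨
      filled (levelCurve f U z) ⊆ enclosed (levelCurve f U z') := by
  obtain ⟨o, ho⟩ := hS.enclosedObstacles_nonempty hz
  obtain ⟨p, hp⟩ := (isConnected_of_mem_obstacles ho.1).nonempty
  have ho' := ho
  rw [← hobs] at ho'
  exact nested_of_mem_filled (hS.isCompact_levelCurve hz.1) (hS.isConnected_levelCurve hz.1)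
    (hS.isCompact_levelCurve hz'.1) (hS.isConnected_levelCurve hz'.1)
    (disjoint_levelCurve hne) (ho.2 hp) (ho'.2 hp)

/-- If `Λ_z` surrounds `Λ_{z'}` and no further obstacles, it has a single bounded face. -/
theorem connectedComponentIn_eq_enclosed (hS : LevelCurveSetting f U G)
    (hz : z ∈ regularSet f G) (hz' : z' ∈ regularSet f G)
    (hobs : enclosedObstacles f G (levelCurve f U z') = enclosedObstacles f G (levelCurve f U z))
    (hsub : filled (levelCurve f U z') ⊆ enclosed (levelCurve f U z)) {x : ℂ}
    (hx : x ∈ enclosed (levelCurve f U z)) :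
    connectedComponentIn (levelCurve f U z)ᶜ x = enclosed (levelCurve f U z) := by
  set M := levelCurve f U z with hM
  set M' := levelCurve f U z' with hM'
  -- Each bounded face holds an obstacle, which `M'` also surrounds. The connected set `filled M'`
  -- therefore lies in that face, so all bounded faces contain `z'`.
  have key : ∀ y ∈ enclosed M, z' ∈ connectedComponentIn Mᶜ y := by
    intro y hy
    obtain ⟨o, ho, hoy⟩ := hS.exists_obstacle_subset_face hz hy
    have ho' : o ∈ enclosedObstacles f G M' := by
      rw [hobs]
      exact ⟨ho, hoy.trans ((connectedComponentIn_subset_enclosed hy).trans enclosed_subset_filled)⟩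
    obtain ⟨p, hp⟩ := (isConnected_of_mem_obstacles ho).nonempty
    have hc := (isPreconnected_filled (hS.isCompact_levelCurve hz'.1).isClosed
      (hS.isConnected_levelCurve hz'.1)).subset_connectedComponentIn (F := Mᶜ) (ho'.2 hp)
      (hsub.trans enclosed_subset_compl)
    rw [connectedComponentIn_eq (hoy hp)]
    exact hc (subset_filled (hS.mem_levelCurve hz'.1))
  refine Subset.antisymm (connectedComponentIn_subset_enclosed hx) fun y hy => ?_
  rw [connectedComponentIn_eq (key x hx), ← connectedComponentIn_eq (key y hy)]
  exact mem_connectedComponentIn hy.2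

theorem isPreconnected_enclosed (hS : LevelCurveSetting f U G)
    (hz : z ∈ regularSet f G) (hz' : z' ∈ regularSet f G)
    (hobs : enclosedObstacles f G (levelCurve f U z') = enclosedObstacles f G (levelCurve f U z))
    (hsub : filled (levelCurve f U z') ⊆ enclosed (levelCurve f U z)) :
    IsPreconnected (enclosed (levelCurve f U z)) := by
  obtain ⟨x, hx⟩ := hS.enclosed_nonempty hz
  rw [← hS.connectedComponentIn_eq_enclosed hz hz' hobs hsub hx]
  exact isPreconnected_connectedComponentIn

theorem sdiff_subset_regularSet (hS : LevelCurveSetting f U G)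
    (hz : z ∈ regularSet f G)
    (hobs : enclosedObstacles f G (levelCurve f U z') = enclosedObstacles f G (levelCurve f U z)) :
    enclosed (levelCurve f U z) \ filled (levelCurve f U z') ⊆ regularSet f G := by
  rintro x ⟨hx, hx'⟩
  by_contra hxR
  obtain ⟨o, ho, hxo, hox⟩ := exists_mem_obstacles (hS.levelCurve_subset_regularSet hz) hx hxR
  have : o ∈ enclosedObstacles f G (levelCurve f U z') := by
    rw [hobs]
    exact ⟨ho, hox.trans ((connectedComponentIn_subset_enclosed hx).trans enclosed_subset_filled)⟩
  exact hx' (this.2 hxo)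

/-- Between two nested level curves surrounding the same obstacles, the modulus is strictly between
its values on the curves. -/
theorem extMod_mem_Ioo (hS : LevelCurveSetting f U G)
    (hz : z ∈ regularSet f G) (hz' : z' ∈ regularSet f G)
    (hobs : enclosedObstacles f G (levelCurve f U z') = enclosedObstacles f G (levelCurve f U z))
    {x : ℂ} (hx : x ∈ enclosed (levelCurve f U z) \ filled (levelCurve f U z')) :
    extMod f x ∈ Ioo (min (extMod f z) (extMod f z')) (max (extMod f z) (extMod f z')) := by
  set M := levelCurve f U z with hM
  set M' := levelCurve f U z' with hM'
  set R := enclosed M \ filled M' with hR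
  have hMk : IsCompact M := hS.isCompact_levelCurve hz.1
  have hMk' : IsCompact M' := hS.isCompact_levelCurve hz'.1
  have hRR : R ⊆ regularSet f G := hS.sdiff_subset_regularSet hz hobs
  have hRo : IsOpen R := (isOpen_enclosed hMk.isClosed).sdiff (isCompact_filled hMk').isClosed
  have hRs : R ⊆ filled M := sdiff_subset.trans enclosed_subset_filled
  have hRb : Bornology.IsBounded R := (isBounded_filled hMk.isBounded).subset hRs
  have hfr : frontier R ⊆ M ∪ M' := by
    intro w hw
    rw [hRo.frontier_eq] at hw
    have h1 : w ∈ filled M := closure_minimal hRs (isCompact_filled hMk).isClosed hw.1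
    by_contra hcon
    rw [mem_union, not_or] at hcon
    have h2 : w ∈ filled M' := by
      by_contra h; exact hw.2 ⟨⟨h1, hcon.1⟩, h⟩
    obtain ⟨y, hy, hyR⟩ := mem_closure_iff.1 hw.1 _ (isOpen_enclosed hMk'.isClosed) ⟨h2, hcon.2⟩
    exact hyR.2 hy.1
  have hcl : closure R ⊆ regularSet f G := by
    rw [closure_eq_self_union_frontier]
    exact union_subset hRR (hfr.trans (union_subset (hS.levelCurve_subset_regularSet hz)
      (hS.levelCurve_subset_regularSet hz')))
  have hxi : x ∈ interior R := by rwa [hRo.interior_eq]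
  constructor
  · refine hS.lt_extMod_of_frontier hRb hcl (fun w hw => ?_) x hxi
    rcases hfr hw with h | h
    · exact (min_le_left _ _).trans (extMod_eq_of_mem_levelCurve h).ge
    · exact (min_le_right _ _).trans (extMod_eq_of_mem_levelCurve h).ge
  · refine hS.extMod_lt_of_frontier hRb hcl (fun w hw => ?_) x hxi
    rcases hfr hw with h | h
    · exact (extMod_eq_of_mem_levelCurve h).le.trans (le_max_left _ _)
    · exact (extMod_eq_of_mem_levelCurve h).le.trans (le_max_right _ _)

/-- Equal values leave no room for the modulus on the ring, so the ring is empty. Then the interior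
of the outer curve is clopen, which is impossible. -/
theorem extMod_ne_of_nested (hS : LevelCurveSetting f U G)
    (hz : z ∈ regularSet f G) (hz' : z' ∈ regularSet f G)
    (hobs : enclosedObstacles f G (levelCurve f U z') = enclosedObstacles f G (levelCurve f U z))
    (hsub : filled (levelCurve f U z') ⊆ enclosed (levelCurve f U z)) :
    extMod f z ≠ extMod f z' := by
  intro heq
  have hMk : IsCompact (levelCurve f U z) := hS.isCompact_levelCurve hz.1
  have hMk' : IsCompact (levelCurve f U z') := hS.isCompact_levelCurve hz'.1
  have hemp : ¬ (enclosed (levelCurve f U z) \ filled (levelCurve f U z')).Nonempty := by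
    rintro ⟨x, hx⟩
    have := hS.extMod_mem_Ioo hz hz' hobs hx
    rw [heq, min_self, max_self, Ioo_self] at this
    exact this
  rw [not_nonempty_iff_eq_empty, sdiff_eq_empty] at hemp
  have h1 : enclosed (levelCurve f U z) = filled (levelCurve f U z') := hemp.antisymm hsub
  have h2 : IsClopen (enclosed (levelCurve f U z)) :=
    ⟨h1 ▸ (isCompact_filled hMk').isClosed, isOpen_enclosed hMk.isClosed⟩
  have h3 := h2.eq_univ (hS.enclosed_nonempty hz)
  have h4 : z ∈ enclosed (levelCurve f U z) := h3 ▸ mem_univ z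
  exact h4.2 (hS.mem_levelCurve hz.1)

theorem nested_of_ne (hS : LevelCurveSetting f U G)
    (hz : z ∈ regularSet f G) (hz' : z' ∈ regularSet f G) (hne : extMod f z ≠ extMod f z')
    (hobs : enclosedObstacles f G (levelCurve f U z') = enclosedObstacles f G (levelCurve f U z)) :
    filled (levelCurve f U z') ⊆ enclosed (levelCurve f U z) ∨
      filled (levelCurve f U z) ⊆ enclosed (levelCurve f U z') := by
  refine hS.nested_of_enclosedObstacles_eq hz hz' (fun h => hne ?_) hobs
  have : z ∈ levelCurve f U z' := h ▸ hS.mem_levelCurve hz.1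
  exact extMod_eq_of_mem_levelCurve this

theorem levelCurve_eq_of_extMod_eq (hS : LevelCurveSetting f U G)
    (hz : z ∈ regularSet f G) (hz' : z' ∈ regularSet f G) (heq : extMod f z = extMod f z')
    (hobs : enclosedObstacles f G (levelCurve f U z') = enclosedObstacles f G (levelCurve f U z)) :
    levelCurve f U z = levelCurve f U z' := by
  by_contra hne
  rcases hS.nested_of_enclosedObstacles_eq hz hz' hne hobs with h | h
  · exact hS.extMod_ne_of_nested hz hz' hobs h heq
  · exact hS.extMod_ne_of_nested hz' hz hobs.symm h heq.symm

end Nested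

/-! ### Absence of critical points, and trapping of nearby curves -/

/-- A level curve nested between two others that surround the same obstacles contains no critical
point. -/
theorem not_isCriticalPt_of_nested (hS : LevelCurveSetting f U G) {z₁ z z₂ : ℂ}
    (hz₁ : z₁ ∈ regularSet f G) (hz : z ∈ regularSet f G) (hz₂ : z₂ ∈ regularSet f G)
    (h₁ : enclosedObstacles f G (levelCurve f U z₁) = enclosedObstacles f G (levelCurve f U z))
    (h₂ : enclosedObstacles f G (levelCurve f U z) = enclosedObstacles f G (levelCurve f U z₂))
    (hs₁ : filled (levelCurve f U z₁) ⊆ enclosed (levelCurve f U z))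
    (hs₂ : filled (levelCurve f U z) ⊆ enclosed (levelCurve f U z₂)) {c : ℂ}
    (hc : c ∈ levelCurve f U z) : ¬ IsCriticalPt f c := by
  rintro ⟨hca, hcd⟩
  set M := levelCurve f U z with hM
  have hMk : IsCompact M := hS.isCompact_levelCurve hz.1
  have hcR := hS.levelCurve_subset_regularSet hz hc
  have hct : extMod f c = extMod f z := extMod_eq_of_mem_levelCurve hc
  have hVo : IsOpen (enclosed M) := isOpen_enclosed hMk.isClosed
  have hVc : IsPreconnected (enclosed M) := hS.isPreconnected_enclosed hz hz₁ h₁ hs₁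
  have hWo : IsOpen (outerFace M) := isOpen_outerFace hMk.isClosed
  have hWc : IsPreconnected (outerFace M) := isPreconnected_outerFace hMk.isBounded
  have hd : Disjoint (enclosed M) (outerFace M) := Set.disjoint_left.2 fun _ h h' => h.1 h'
  have hcV : c ∉ enclosed M := fun h => h.2 hc
  have hcW : c ∉ outerFace M := fun h => h.1 hc
  set R := enclosed (levelCurve f U z₂) \ filled (levelCurve f U z₁) with hR
  have hRo : IsOpen R := (isOpen_enclosed (hS.isCompact_levelCurve hz₂.1).isClosed).sdiff
    (isCompact_filled (hS.isCompact_levelCurve hz₁.1)).isClosed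
  have hMR : M ⊆ R := fun w hw => ⟨hs₂ (subset_filled hw), fun h => (hs₁ h).2 hw⟩
  have hRreg : R ⊆ regularSet f G := hS.sdiff_subset_regularSet hz₂ (h₁.trans h₂)
  have hzR := hS.extMod_mem_Ioo hz₂ hz₁ (h₁.trans h₂) (hMR (hS.mem_levelCurve hz.1))
  have hin : ∀ w ∈ R, w ∈ enclosed M →
      extMod f w ∈ Ioo (min (extMod f z) (extMod f z₁)) (max (extMod f z) (extMod f z₁)) :=
    fun w hw hwM => hS.extMod_mem_Ioo hz hz₁ h₁ ⟨hwM, hw.2⟩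
  have hout : ∀ w ∈ R, w ∈ outerFace M →
      extMod f w ∈ Ioo (min (extMod f z₂) (extMod f z)) (max (extMod f z₂) (extMod f z)) :=
    fun w hw hwM => hS.extMod_mem_Ioo hz₂ hz h₂ ⟨hw.1, fun h => h hwM⟩
  have hcases : ∀ w, extMod f w ≠ extMod f z → w ∈ enclosed M ∨ w ∈ outerFace M := by
    intro w hw
    by_contra h
    rw [not_or] at h
    rcases mem_filled_cases (show w ∈ filled M from h.2) with h' | h'
    · exact hw (extMod_eq_of_mem_levelCurve h')
    · exact h.1 h'
  have hf0 : f c ≠ 0 := fun h => hcR.2.1 (by rw [extMod_of_analyticAt hca, h, enorm_zero])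
  obtain ⟨e, α, ρ, he, hα, hα2, hρ, hray⟩ :=
    hca.exists_alternating_rays (hS.not_eventually_eq hcR.1) hf0 hcd
  obtain ⟨r, hr, hball⟩ := Metric.isOpen_iff.1 hRo c (hMR hc)
  have hmemR : ∀ s : ℝ, 0 < s → s ≤ min ρ (r / 2) → ∀ j : ℕ,
      c + s * (e * Complex.exp (α * Complex.I) ^ j) ∈ R := by
    intro s hs hs' j
    apply hball
    rw [Metric.mem_ball, dist_eq_norm, add_sub_cancel_left, norm_mul, norm_mul, norm_pow, he,
      Complex.norm_exp_ofReal_mul_I, one_pow, mul_one, mul_one, Complex.norm_real,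
      Real.norm_eq_abs, abs_of_pos hs]
    have := hs'.trans (min_le_right _ _)
    linarith
  have hcmp : ∀ w ∈ R, (‖f c‖ < ‖f w‖ → extMod f z < extMod f w) ∧
      (‖f w‖ < ‖f c‖ → extMod f w < extMod f z) := by
    intro w hw
    have hwa := hS.analyticAt (hRreg hw).1 (hRreg hw).2.2
    rw [← hct, extMod_of_analyticAt hwa, extMod_of_analyticAt hca]
    exact ⟨fun h => lt_of_not_ge fun h' => not_le.2 h (enorm_le_iff_norm_le.1 h'),
      fun h => lt_of_not_ge fun h' => not_le.2 h (enorm_le_iff_norm_le.1 h')⟩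
  have heven : ∀ s : ℝ, 0 < s → s ≤ min ρ (r / 2) → ∀ j : ℕ, Even j →
      extMod f z < extMod f (c + s * (e * Complex.exp (α * Complex.I) ^ j)) := fun s hs hs' j hj =>
    (hcmp _ (hmemR s hs hs' j)).1 ((hray s hs (hs'.trans (min_le_left _ _)) j).1 hj)
  have hodd : ∀ s : ℝ, 0 < s → s ≤ min ρ (r / 2) → ∀ j : ℕ, Odd j →
      extMod f (c + s * (e * Complex.exp (α * Complex.I) ^ j)) < extMod f z := fun s hs hs' j hj =>
    (hcmp _ (hmemR s hs hs' j)).2 ((hray s hs (hs'.trans (min_le_left _ _)) j).2 hj)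
  have hρ' : 0 < min ρ (r / 2) := by positivity
  -- Here `V` is the side of the curve where the modulus is larger and `W` the side where it is
  -- smaller. Whether `V` is the outside or the inside depends on which of `z₁`, `z₂` has the larger
  -- modulus.
  have concl : ∀ V W : Set ℂ, IsOpen V → IsPreconnected V → IsPreconnected W → Disjoint V W →
      c ∉ V → c ∉ W → (∀ w ∈ R, extMod f z < extMod f w → w ∈ V) →
      (∀ w ∈ R, extMod f w < extMod f z → w ∈ W) → False := by
    intro V W hV hVc hWc hVW hcV hcW hgt hlt
    refine not_alternating_rays hV hVc hWc hVW hcV hcW he hα hα2 hρ' ?_ ?_ ?_ ?_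
    · intro s hs hs'
      have h1 := hmemR s hs hs' 0
      have h2 := heven s hs hs' 0 (by decide)
      rw [pow_zero, mul_one] at h1 h2
      exact hgt _ h1 h2
    · intro s hs hs'
      have h1 := hmemR s hs hs' 1
      have h2 := hodd s hs hs' 1 (by decide)
      rw [pow_one] at h1 h2
      exact hlt _ h1 h2
    · exact fun s hs hs' => hgt _ (hmemR s hs hs' 2) (heven s hs hs' 2 (by decide))
    · exact fun s hs hs' => hlt _ (hmemR s hs hs' 3) (hodd s hs hs' 3 (by decide))
  rcases lt_or_ge (extMod f z₁) (extMod f z₂) with hlt | hge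
  · rw [min_eq_right hlt.le, max_eq_left hlt.le] at hzR
    refine concl _ _ hWo hWc hVc hd.symm hcW hcV ?_ ?_
    · intro w hw hwz
      refine (hcases w hwz.ne').resolve_left fun h => ?_
      have := (hin w hw h).2
      rw [max_eq_left hzR.1.le] at this
      exact lt_asymm this hwz
    · intro w hw hwz
      refine (hcases w hwz.ne).resolve_right fun h => ?_
      have := (hout w hw h).1
      rw [min_eq_right hzR.2.le] at this
      exact lt_asymm this hwz
  · rw [min_eq_left hge, max_eq_right hge] at hzR
    refine concl _ _ hVo hVc hWc hd hcV hcW ?_ ?_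
    · intro w hw hwz
      refine (hcases w hwz.ne').resolve_right fun h => ?_
      have := (hout w hw h).2
      rw [max_eq_right hzR.1.le] at this
      exact lt_asymm this hwz
    · intro w hw hwz
      refine (hcases w hwz.ne).resolve_left fun h => ?_
      have := (hin w hw h).1
      rw [min_eq_left hzR.2.le] at this
      exact lt_asymm this hwz

/-- Level curves of nearby level which come close to a compact component of a level set stay close
to it. -/
theorem exists_trapping_nhds (hS : LevelCurveSetting f U G) {x : ℂ} {η : ℝ≥0∞}
    (hx : x ∈ closure G ∩ extMod f ⁻¹' {η})
    (hk : IsCompact (connectedComponentIn (closure G ∩ extMod f ⁻¹' {η}) x)) {O : Set ℂ}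
    (hO : IsOpen O) (hsub : connectedComponentIn (closure G ∩ extMod f ⁻¹' {η}) x ⊆ O) :
    ∃ N, IsOpen N ∧ connectedComponentIn (closure G ∩ extMod f ⁻¹' {η}) x ⊆ N ∧
      IsCompact (closure N) ∧ closure N ⊆ O ∧ ∃ I ∈ 𝓝 η, ∀ w ∈ G, extMod f w ∈ I →
        (levelCurve f U w ∩ N).Nonempty → levelCurve f U w ⊆ N := by
  obtain ⟨N, hN, hxN, hNk, hNO, hfr⟩ := exists_isolating_nhds (hS.isClosed_level η) hx hk hO hsub
  have hFk : IsCompact (frontier N ∩ closure G) :=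
    (hNk.of_isClosed_subset isClosed_frontier frontier_subset_closure).inter_right isClosed_closure
  have hik : IsCompact (extMod f '' (frontier N ∩ closure G)) :=
    hFk.image_of_continuousOn fun w hw => (hS.continuousAt_extMod hw.2).continuousWithinAt
  -- A level is admissible if it is not attained on the compact set `frontier N ∩ closure G`. A
  -- curve of such a level cannot cross `frontier N`.
  refine ⟨N, hN, hxN, hNk, hNO, _, hik.isClosed.isOpen_compl.mem_nhds ?_, fun w hw hwI hne => ?_⟩
  · rintro ⟨y, hy, hyη⟩
    exact Set.disjoint_left.1 hfr hy.1 ⟨hy.2, hyη⟩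
  · refine (hS.isConnected_levelCurve hw).isPreconnected.subset_of_disjoint_frontier hne ?_
    rw [Set.disjoint_left]
    intro y hy hyf
    exact hwI ⟨y, ⟨hyf, subset_closure (hS.levelCurve_subset hw hy)⟩,
      extMod_eq_of_mem_levelCurve hy⟩

end LevelCurveSetting

/-! ### Sequences approaching `L` -/

/-- A sequence which converges to a point of `L`, or to infinity if `L` is unbounded. -/
def Approaches (z : ℕ → ℂ) (L : Set ℂ) : Prop :=
  (∃ a ∈ L, Tendsto z atTop (𝓝 a)) ∨
    (¬ Bornology.IsBounded L ∧ Tendsto z atTop (Bornology.cobounded ℂ))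

theorem Approaches.comp {z : ℕ → ℂ} {L : Set ℂ} (h : Approaches z L) {φ : ℕ → ℕ}
    (hφ : StrictMono φ) : Approaches (z ∘ φ) L := by
  rcases h with ⟨a, ha, h⟩ | ⟨hb, h⟩
  · exact Or.inl ⟨a, ha, h.comp hφ.tendsto_atTop⟩
  · exact Or.inr ⟨hb, h.comp hφ.tendsto_atTop⟩

theorem Approaches.exists_tendsto {z : ℕ → ℂ} {L : Set ℂ} (h : Approaches z L)
    (hb : Bornology.IsBounded L) : ∃ a ∈ L, Tendsto z atTop (𝓝 a) :=
  h.resolve_right fun h' => h'.1 hb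

/-- A sequence approaching `L` eventually leaves each compact set disjoint from `L`. -/
theorem Approaches.eventually_notMem {z : ℕ → ℂ} {L S : Set ℂ} (h : Approaches z L)
    (hS : IsCompact S) (hd : Disjoint S L) : ∀ᶠ n in atTop, z n ∉ S := by
  rcases h with ⟨a, ha, h⟩ | ⟨-, h⟩
  · exact h.eventually (hS.isClosed.isOpen_compl.eventually_mem
      (show a ∈ Sᶜ from fun haS => Set.disjoint_left.1 hd haS ha))
  · exact h.eventually (Bornology.isCobounded_def.1 (Bornology.isCobounded_compl_iff.2
      hS.isBounded))

theorem exists_subseq_approaches {z : ℕ → ℂ} {L : Set ℂ} (hL : IsClosed L) (hne : L.Nonempty)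
    (hz : ∀ n : ℕ, Metric.infDist (z n) L < 1 / ((n : ℝ) + 1)) :
    ∃ φ : ℕ → ℕ, StrictMono φ ∧ Approaches (z ∘ φ) L := by
  have h0 : Tendsto (fun n => Metric.infDist (z n) L) atTop (𝓝 0) :=
    squeeze_zero (fun _ => Metric.infDist_nonneg) (fun n => (hz n).le)
      tendsto_one_div_add_atTop_nhds_zero_nat
  -- If the sequence escapes to infinity, then `L` is unbounded, since the 1-thickening of `L`
  -- contains its tail. Otherwise a subsequence is bounded and converges, and its limit has distance
  -- `0` to `L`.
  by_cases ht : Tendsto z atTop (Bornology.cobounded ℂ)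
  · refine ⟨id, strictMono_id, Or.inr ⟨fun hb => ?_, ht⟩⟩
    have h1 : Bornology.IsBounded (Metric.thickening 1 L) := hb.thickening
    have h2 : ∀ᶠ n in atTop, z n ∉ Metric.thickening 1 L :=
      ht.eventually (Bornology.isCobounded_def.1 (Bornology.isCobounded_compl_iff.2 h1))
    obtain ⟨n, hn, hn'⟩ := (h2.and (h0.eventually (gt_mem_nhds one_pos))).exists
    exact hn ((Metric.mem_thickening_iff_infDist_lt hne).2 hn')
  · rw [← tendsto_norm_atTop_iff_cobounded, tendsto_atTop] at ht
    push Not at ht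
    obtain ⟨R, hR⟩ := ht
    obtain ⟨a, -, φ, hφ, ha⟩ := tendsto_subseq_of_frequently_bounded
      (Metric.isBounded_closedBall (x := (0 : ℂ)) (r := R))
      (hR.mono fun n hn => by simpa using hn.le)
    refine ⟨φ, hφ, Or.inl ⟨a, ?_, ha⟩⟩
    have h1 := ((Metric.continuous_infDist_pt L).tendsto a).comp ha
    have h2 : Metric.infDist a L = 0 := tendsto_nhds_unique h1 (h0.comp hφ.tendsto_atTop)
    exact (hL.mem_iff_infDist_zero hne).2 h2

/-- The pigeonhole principle in the form used for the finitely many possible sets of surrounded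
obstacles. -/
theorem frequently_and_eq_of_finite {β : Type*} {P : ℕ → Prop} {g : ℕ → β} {F : Set β}
    (hF : F.Finite) (hg : ∀ n, g n ∈ F) (h : ∃ᶠ n in atTop, P n) :
    ∃ b, ∃ᶠ n in atTop, P n ∧ g n = b := by
  by_contra hcon
  push Not at hcon
  have h1 : ∀ᶠ n in atTop, ∀ b ∈ F, P n → g n ≠ b :=
    (eventually_all_finite hF).2 fun b _ => hcon b
  exact h (h1.mono fun n hn hP => hn (g n) (hg n) hP rfl)

/-! ### Level curves close to `L` -/

namespace LevelCurveSetting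

variable {f : ℂ → ℂ} {U G L : Set ℂ} {η : ℝ≥0∞}

section Curve

theorem isConnected_of_curve
    (hL : IsLevelCurveIn f U G L ∨ IsComponentOf (frontier G) L) : IsConnected L := by
  rcases hL with ⟨⟨ε, x, hx, rfl⟩, -⟩ | ⟨x, hx, rfl⟩ <;>
  exact isConnected_connectedComponentIn_iff.2 hx

theorem curve_subset_closure
    (hL : IsLevelCurveIn f U G L ∨ IsComponentOf (frontier G) L) : L ⊆ closure G := by
  rcases hL with ⟨-, h⟩ | ⟨x, -, rfl⟩
  · exact h.trans subset_closure
  · exact (connectedComponentIn_subset _ _).trans frontier_subset_closure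

/-- This treats level curves and boundary components alike. For the latter, the component of the
level set cannot enter `G`: at a point `w` of `G` it would equal `Λ_w`, which avoids the frontier.
-/
theorem curve_eq_connectedComponentIn (hS : LevelCurveSetting f U G)
    (hL : IsLevelCurveIn f U G L ∨ IsComponentOf (frontier G) L)
    (hη : ∀ w ∈ L, extMod f w = η) {x : ℂ} (hx : x ∈ L) :
    L = connectedComponentIn (closure G ∩ extMod f ⁻¹' {η}) x := by
  have hsub : L ⊆ closure G ∩ extMod f ⁻¹' {η} := fun w hw => ⟨curve_subset_closure hL hw, hη w hw⟩
  refine Subset.antisymm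
    ((isConnected_of_curve hL).isPreconnected.subset_connectedComponentIn hx hsub) ?_
  rcases hL with ⟨⟨ε, y, hy, rfl⟩, hG⟩ | ⟨y, hy, rfl⟩
  · have h1 : η = ε := by
      rw [← hη x hx]; exact (connectedComponentIn_subset _ _ hx).2
    rw [connectedComponentIn_eq hx, h1]
    exact connectedComponentIn_mono x fun w hw => ⟨hS.closure_subset hw.1, hw.2⟩
  · have hxf : x ∈ frontier G := connectedComponentIn_subset _ _ hx
    rw [connectedComponentIn_eq hx]
    refine isPreconnected_connectedComponentIn.subset_connectedComponentIn
      (mem_connectedComponentIn (hsub hx)) fun w hw => ?_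
    have hwX := connectedComponentIn_subset _ _ hw
    rw [hS.isOpen.frontier_eq]
    refine ⟨hwX.1, fun hwG => ?_⟩
    have hwη : extMod f w = η := hwX.2
    have h1 := hS.levelCurve_eq_connectedComponentIn hwG
    rw [hwη, ← connectedComponentIn_eq hw] at h1
    have h2 : x ∈ levelCurve f U w := h1 ▸ mem_connectedComponentIn (hsub hx)
    rw [hS.isOpen.frontier_eq] at hxf
    exact hxf.2 (hS.levelCurve_subset hwG h2)

theorem isClosed_curve (hS : LevelCurveSetting f U G)
    (hL : IsLevelCurveIn f U G L ∨ IsComponentOf (frontier G) L)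
    (hη : ∀ w ∈ L, extMod f w = η) : IsClosed L := by
  obtain ⟨x, hx⟩ := (isConnected_of_curve hL).nonempty
  rw [hS.curve_eq_connectedComponentIn hL hη hx]
  exact isClosed_connectedComponentIn_of_isClosed (hS.isClosed_level η) x

theorem disjoint_levelCurve_curve (hS : LevelCurveSetting f U G)
    (hL : IsLevelCurveIn f U G L ∨ IsComponentOf (frontier G) L)
    (hη : ∀ w ∈ L, extMod f w = η) {z : ℂ} (hz : z ∈ G) (hzL : z ∉ L) :
    Disjoint (levelCurve f U z) L := by
  rw [Set.disjoint_left]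
  intro y hy hyL
  have hyG := hS.levelCurve_subset hz hy
  have h1 := hS.curve_eq_connectedComponentIn hL hη hyL
  rw [← hη y hyL, ← hS.levelCurve_eq_connectedComponentIn hyG, levelCurve_eq_of_mem hy] at h1
  exact hzL (h1 ▸ hS.mem_levelCurve hz)

theorem curve_subset_frontier (hS : LevelCurveSetting f U G)
    (hL : IsLevelCurveIn f U G L ∨ IsComponentOf (frontier G) L)
    (hb : ¬ Bornology.IsBounded L) : L ⊆ frontier G := by
  rcases hL with h | ⟨x, -, rfl⟩
  · exact absurd (hS.bounded_curves L h) hb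
  · exact connectedComponentIn_subset _ _

theorem eq_one_of_unbounded (hS : LevelCurveSetting f U G)
    (hL : IsLevelCurveIn f U G L ∨ IsComponentOf (frontier G) L)
    (hη : ∀ w ∈ L, extMod f w = η) (hb : ¬ Bornology.IsBounded L) : η = 1 := by
  obtain ⟨x, hx⟩ := (isConnected_of_curve hL).nonempty
  rw [← hη x hx]
  rcases hL with h | h
  · exact absurd (hS.bounded_curves L h) hb
  · exact hS.unbounded_boundary L h hb x hx

end Curve

section Sequence

variable {z : ℕ → ℂ}

/-- This is continuity at a finite limit. At infinity `L` is unbounded, so `η = 1`, which is also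
the limit of the modulus in `G`. -/
theorem tendsto_extMod (hS : LevelCurveSetting f U G)
    (hL : IsLevelCurveIn f U G L ∨ IsComponentOf (frontier G) L)
    (hη : ∀ w ∈ L, extMod f w = η) (hz : ∀ n, z n ∈ G) (ha : Approaches z L) :
    Tendsto (fun n => extMod f (z n)) atTop (𝓝 η) := by
  rcases ha with ⟨a, haL, ha⟩ | ⟨hb, ht⟩
  · rw [← hη a haL]
    exact (hS.continuousAt_extMod (curve_subset_closure hL haL)).tendsto.comp ha
  · have hG : ¬ Bornology.IsBounded G := by
      intro hG
      obtain ⟨n, hn⟩ := (ht.eventually (Bornology.isCobounded_def.1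
        (Bornology.isCobounded_compl_iff.2 hG))).exists
      exact hn (hz n)
    rw [hS.eq_one_of_unbounded hL hη hb]
    exact (hS.tendsto_infinity hG).comp
      (tendsto_inf.2 ⟨ht, tendsto_principal.2 (Eventually.of_forall hz)⟩)

theorem eventually_mem_regularSet (hS : LevelCurveSetting f U G)
    (hz : ∀ n, z n ∈ G) (hzL : ∀ n, z n ∉ L) (ha : Approaches z L) :
    ∀ᶠ n in atTop, z n ∈ regularSet f G := by
  have hfin := hS.finite_zeros_poles.sdiff (t := L)
  filter_upwards [ha.eventually_notMem hfin.isCompact disjoint_sdiff_left] with n hn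
  refine ⟨hz n, not_or.1 fun h => hn ⟨⟨hz n, h⟩, hzL n⟩⟩

/-- Otherwise infinitely many `z n` have modulus `η` and the same obstacles, so they lie on one
level curve. That curve is compact and disjoint from `L`, and the sequence must leave it. -/
theorem eventually_extMod_ne (hS : LevelCurveSetting f U G)
    (hL : IsLevelCurveIn f U G L ∨ IsComponentOf (frontier G) L)
    (hη : ∀ w ∈ L, extMod f w = η) (hz : ∀ n, z n ∈ G) (hzL : ∀ n, z n ∉ L)
    (ha : Approaches z L) : ∀ᶠ n in atTop, extMod f (z n) ≠ η := by
  by_contra hcon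
  have hf : ∃ᶠ n in atTop, extMod f (z n) = η := by
    intro h; exact hcon h
  have hf' := hf.and_eventually (hS.eventually_mem_regularSet hz hzL ha)
  obtain ⟨S, hS'⟩ := frequently_and_eq_of_finite hS.finite_obstacles.finite_subsets
    (g := fun n => enclosedObstacles f G (levelCurve f U (z n))) (fun n o ho => ho.1) hf'
  obtain ⟨m, ⟨hm, hmR⟩, hmS⟩ := hS'.exists
  obtain ⟨n, ⟨⟨hn, hnR⟩, hnS⟩, hn'⟩ := (hS'.and_eventually
    (ha.eventually_notMem (hS.isCompact_levelCurve (hz m))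
      (hS.disjoint_levelCurve_curve hL hη (hz m) (hzL m)))).exists
  apply hn'
  rw [hS.levelCurve_eq_of_extMod_eq hmR hnR (hm.trans hn.symm) (hnS.trans hmS.symm)]
  exact hS.mem_levelCurve (hz n)

theorem eventually_levelCurve_subset_thickening (hS : LevelCurveSetting f U G)
    (hL : IsLevelCurveIn f U G L ∨ IsComponentOf (frontier G) L)
    (hη : ∀ w ∈ L, extMod f w = η) (hz : ∀ n, z n ∈ G) (ha : Approaches z L)
    (hb : Bornology.IsBounded L) {ε : ℝ} (hε : 0 < ε) :
    ∀ᶠ n in atTop, levelCurve f U (z n) ⊆ Metric.thickening ε L := by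
  obtain ⟨a, haL, hza⟩ := ha.exists_tendsto hb
  have hLk : IsCompact L := Metric.isCompact_of_isClosed_isBounded (hS.isClosed_curve hL hη) hb
  have hLe := hS.curve_eq_connectedComponentIn hL hη haL
  have haX : a ∈ closure G ∩ extMod f ⁻¹' {η} := ⟨curve_subset_closure hL haL, hη a haL⟩
  obtain ⟨N, hN, hLN, -, hNε, I, hI, hNI⟩ := hS.exists_trapping_nhds haX (hLe ▸ hLk)
    Metric.isOpen_thickening (by rw [← hLe]; exact Metric.self_subset_thickening hε L)
  rw [← hLe] at hLN
  filter_upwards [hza.eventually (hN.eventually_mem (hLN haL)),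
    (hS.tendsto_extMod hL hη hz ha).eventually hI] with n hn hnI
  exact (hNI _ (hz n) hnI ⟨z n, hS.mem_levelCurve (hz n), hn⟩).trans (subset_closure.trans hNε)

/-- The curves end up in every thickening of `L`, so whatever they accumulate at belongs to the
closed set `L`. -/
theorem mem_of_eventually_inter_ball_nonempty (hS : LevelCurveSetting f U G)
    (hL : IsLevelCurveIn f U G L ∨ IsComponentOf (frontier G) L)
    (hη : ∀ w ∈ L, extMod f w = η) (hz : ∀ n, z n ∈ G) (ha : Approaches z L)
    (hb : Bornology.IsBounded L) {w : ℂ}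
    (hw : ∀ r > 0, ∀ᶠ n in atTop, (levelCurve f U (z n) ∩ Metric.ball w r).Nonempty) : w ∈ L := by
  rw [← (hS.isClosed_curve hL hη).closure_eq, Metric.mem_closure_iff]
  intro ε hε
  obtain ⟨n, ⟨y, hy, hyw⟩, hn⟩ := ((hw (ε / 2) (half_pos hε)).and
    (hS.eventually_levelCurve_subset_thickening hL hη hz ha hb (half_pos hε))).exists
  obtain ⟨l, hl, hyl⟩ := Metric.mem_thickening_iff.1 (hn hy)
  refine ⟨l, hl, ?_⟩
  have := dist_triangle w y l
  rw [Metric.mem_ball, dist_comm] at hyw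
  linarith

/-! ### Curves increasing towards `L` -/

section Increasing

/-- If `L` were inside `Λ_{z n}`, the points `z k` would eventually be inside as well, although
`Λ_{z k}` eventually surrounds `Λ_{z n}`. -/
theorem curve_subset_outerFace (hS : LevelCurveSetting f U G)
    (hL : IsLevelCurveIn f U G L ∨ IsComponentOf (frontier G) L)
    (hη : ∀ w ∈ L, extMod f w = η) (hz : ∀ n, z n ∈ G) (hzL : ∀ n, z n ∉ L) (ha : Approaches z L)
    (hout : ∀ m, ∀ᶠ n in atTop,
      filled (levelCurve f U (z m)) ⊆ enclosed (levelCurve f U (z n))) (n : ℕ) :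
    L ⊆ outerFace (levelCurve f U (z n)) := by
  by_contra hcon
  obtain ⟨x, hx, hx'⟩ := not_subset.1 hcon
  have hMk := hS.isCompact_levelCurve (hz n)
  have hLe : L ⊆ enclosed (levelCurve f U (z n)) :=
    (isConnected_of_curve hL).isPreconnected.subset_enclosed
      (hS.disjoint_levelCurve_curve hL hη (hz n) (hzL n)).subset_compl_left ⟨x, hx, hx'⟩
  have hb : Bornology.IsBounded L :=
    (isBounded_filled hMk.isBounded).subset (hLe.trans enclosed_subset_filled)
  obtain ⟨a, haL, hza⟩ := ha.exists_tendsto hb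
  obtain ⟨k, hk, hk'⟩ := ((hza.eventually ((isOpen_enclosed hMk.isClosed).eventually_mem
    (hLe haL))).and (hout n)).exists
  exact (hk' (enclosed_subset_filled hk)).2 (hS.mem_levelCurve (hz k))

theorem isOpen_iUnion_filled (hS : LevelCurveSetting f U G) (hz : ∀ n, z n ∈ G)
    (hout : ∀ m, ∀ᶠ n in atTop,
      filled (levelCurve f U (z m)) ⊆ enclosed (levelCurve f U (z n))) :
    IsOpen (⋃ n, filled (levelCurve f U (z n))) := by
  rw [isOpen_iff_mem_nhds]
  intro x hx
  obtain ⟨m, hm⟩ := mem_iUnion.1 hx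
  obtain ⟨n, hn⟩ := (hout m).exists
  exact mem_of_superset ((isOpen_enclosed (hS.isCompact_levelCurve (hz n)).isClosed).mem_nhds
    (hn hm)) (enclosed_subset_filled.trans (subset_iUnion_of_subset n Subset.rfl))

/-- A ball that meets the interior of a curve but not the curve lies wholly inside, which would make
`w` a point of the open union. -/
theorem eventually_inter_ball_nonempty_of_iUnion (hS : LevelCurveSetting f U G)
    (hz : ∀ n, z n ∈ G)
    (hout : ∀ m, ∀ᶠ n in atTop,
      filled (levelCurve f U (z m)) ⊆ enclosed (levelCurve f U (z n))) {w : ℂ}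
    (hw : w ∈ frontier (⋃ n, filled (levelCurve f U (z n)))) {r : ℝ} (hr : 0 < r) :
    ∀ᶠ n in atTop, (levelCurve f U (z n) ∩ Metric.ball w r).Nonempty := by
  rw [(hS.isOpen_iUnion_filled hz hout).frontier_eq] at hw
  obtain ⟨y, hy, hyD⟩ := mem_closure_iff.1 hw.1 _ Metric.isOpen_ball (Metric.mem_ball_self hr)
  obtain ⟨m, hm⟩ := mem_iUnion.1 hyD
  filter_upwards [hout m] with n hn
  by_contra hcon
  have h1 : Metric.ball w r ⊆ enclosed (levelCurve f U (z n)) :=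
    Metric.isPreconnected_ball.subset_enclosed (fun x hx hxM => hcon ⟨x, hxM, hx⟩)
      ⟨y, hy, enclosed_subset_filled (hn hm)⟩
  exact hw.2 (mem_iUnion.2 ⟨n, enclosed_subset_filled (h1 (Metric.mem_ball_self hr))⟩)

theorem eventually_subset_enclosed (hS : LevelCurveSetting f U G) (hz : ∀ n, z n ∈ G)
    (hout : ∀ m, ∀ᶠ n in atTop,
      filled (levelCurve f U (z m)) ⊆ enclosed (levelCurve f U (z n))) {K : Set ℂ}
    (hK : IsCompact K) (hKD : K ⊆ ⋃ n, filled (levelCurve f U (z n))) :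
    ∀ᶠ n in atTop, K ⊆ enclosed (levelCurve f U (z n)) := by
  refine hK.induction_on (p := fun K => ∀ᶠ n in atTop, K ⊆ enclosed (levelCurve f U (z n)))
    (Eventually.of_forall fun _ => empty_subset _) ?_ ?_ ?_
  · intro s t hst ht; exact ht.mono fun n hn => hst.trans hn
  · intro s t hs ht; exact (hs.and ht).mono fun n hn => union_subset hn.1 hn.2
  · intro x hx
    obtain ⟨m, hm⟩ := mem_iUnion.1 (hKD hx)
    obtain ⟨k, hk⟩ := (hout m).exists
    exact ⟨_, mem_nhdsWithin_of_mem_nhds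
      ((isOpen_enclosed (hS.isCompact_levelCurve (hz k)).isClosed).mem_nhds (hk hm)),
      (hout k).mono fun n hn => enclosed_subset_filled.trans hn⟩

/-- Level curves increasing towards a bounded `L` exhaust a bounded face of `L`. -/
theorem iUnion_filled_eq (hS : LevelCurveSetting f U G)
    (hL : IsLevelCurveIn f U G L ∨ IsComponentOf (frontier G) L)
    (hη : ∀ w ∈ L, extMod f w = η) (hz : ∀ n, z n ∈ G) (hzL : ∀ n, z n ∉ L) (ha : Approaches z L)
    (hout : ∀ m, ∀ᶠ n in atTop,
      filled (levelCurve f U (z m)) ⊆ enclosed (levelCurve f U (z n)))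
    (hb : Bornology.IsBounded L) :
    (⋃ n, filled (levelCurve f U (z n))) = connectedComponentIn Lᶜ (z 0) ∧
      Bornology.IsBounded (⋃ n, filled (levelCurve f U (z n))) := by
  set D := ⋃ n, filled (levelCurve f U (z n)) with hD
  have hDL : D ⊆ Lᶜ := iUnion_subset fun n x hx hxL =>
    hx (hS.curve_subset_outerFace hL hη hz hzL ha hout n hxL)
  have hDc : IsPreconnected D := by
    refine isPreconnected_of_forall_pair fun x hx y hy => ?_
    obtain ⟨m, hm⟩ := mem_iUnion.1 hx
    obtain ⟨k, hk⟩ := mem_iUnion.1 hy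
    obtain ⟨n, hn, hn'⟩ := ((hout m).and (hout k)).exists
    exact ⟨_, subset_iUnion_of_subset n Subset.rfl, enclosed_subset_filled (hn hm),
      enclosed_subset_filled (hn' hk), isPreconnected_filled
        (hS.isCompact_levelCurve (hz n)).isClosed (hS.isConnected_levelCurve (hz n))⟩
  have hz0 : z 0 ∈ D := mem_iUnion.2 ⟨0, subset_filled (hS.mem_levelCurve (hz 0))⟩
  constructor
  · refine Subset.antisymm (hDc.subset_connectedComponentIn hz0 hDL) ?_
    refine isPreconnected_connectedComponentIn.subset_of_disjoint_frontier
      ⟨z 0, mem_connectedComponentIn (hzL 0), hz0⟩ ?_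
    rw [Set.disjoint_left]
    intro w hw hwf
    exact connectedComponentIn_subset _ _ hw (hS.mem_of_eventually_inter_ball_nonempty hL hη hz ha
      hb fun r hr => hS.eventually_inter_ball_nonempty_of_iUnion hz hout hwf hr)
  · obtain ⟨R, hR⟩ := (hb.thickening (δ := 1)).subset_closedBall 0
    refine (Metric.isBounded_closedBall (x := (0 : ℂ)) (r := R)).subset (iUnion_subset fun m => ?_)
    obtain ⟨n, hn, hn'⟩ := ((hout m).and
      (hS.eventually_levelCurve_subset_thickening hL hη hz ha hb one_pos)).exists
    exact (hn.trans enclosed_subset_filled).trans (filled_subset_closedBall (hn'.trans hR))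

/-- Level curves increasing towards an unbounded `L` exhaust `sc G`. -/
theorem sc_subset_iUnion_filled (hS : LevelCurveSetting f U G)
    (hL : IsLevelCurveIn f U G L ∨ IsComponentOf (frontier G) L)
    (hη : ∀ w ∈ L, extMod f w = η) (hz : ∀ n, z n ∈ G) (ha : Approaches z L)
    (hout : ∀ m, ∀ᶠ n in atTop,
      filled (levelCurve f U (z m)) ⊆ enclosed (levelCurve f U (z n)))
    (hb : ¬ Bornology.IsBounded L) :
    sc G ⊆ ⋃ n, filled (levelCurve f U (z n)) := by
  set D := ⋃ n, filled (levelCurve f U (z n)) with hD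
  have hlim := hS.tendsto_extMod hL hη hz ha
  have hz0 : z 0 ∈ D := mem_iUnion.2 ⟨0, subset_filled (hS.mem_levelCurve (hz 0))⟩
  have hGL : Disjoint G L := by
    rw [Set.disjoint_left]
    intro x hx hxL
    have := hS.curve_subset_frontier hL hb hxL
    rw [hS.isOpen.frontier_eq] at this
    exact this.2 hx
  -- A frontier point `w` of `D` in `G` has modulus `η` by continuity. A trapping neighbourhood of
  -- the compact curve `Λ_w` inside `G` would then hold `z n` for all large `n`, but the sequence
  -- approaches `L`, which is disjoint from `G`.
  have hGD : G ⊆ D := by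
    refine hS.connected.isPreconnected.subset_of_disjoint_frontier ⟨z 0, hz 0, hz0⟩ ?_
    rw [Set.disjoint_left]
    intro w hwG hwf
    have hnear := fun r (hr : 0 < r) => hS.eventually_inter_ball_nonempty_of_iUnion hz hout hwf hr
    have hwη : extMod f w = η := by
      by_contra hne
      obtain ⟨u, v, hu, hv, hwu, hηv, huv⟩ := t2_separation hne
      obtain ⟨r, hr, hball⟩ := Metric.mem_nhds_iff.1
        ((hS.continuousAt_extMod (subset_closure hwG)) (hu.mem_nhds hwu))
      obtain ⟨n, ⟨y, hy, hyw⟩, hn⟩ := ((hnear r hr).and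
        (hlim.eventually (hv.eventually_mem hηv))).exists
      have h1 : extMod f y ∈ u := hball hyw
      rw [extMod_eq_of_mem_levelCurve hy] at h1
      exact Set.disjoint_left.1 huv h1 hn
    have hcw := hS.levelCurve_eq_connectedComponentIn hwG
    rw [hwη] at hcw
    obtain ⟨N, hN, hwN, hNk, hNG, I, hI, hNI⟩ := hS.exists_trapping_nhds (x := w) (η := η)
      ⟨subset_closure hwG, hwη⟩ (hcw ▸ hS.isCompact_levelCurve hwG) hS.isOpen
      (hcw ▸ hS.levelCurve_subset hwG)
    rw [← hcw] at hwN
    obtain ⟨r, hr, hball⟩ := Metric.mem_nhds_iff.1 (hN.mem_nhds (hwN (hS.mem_levelCurve hwG)))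
    obtain ⟨n, ⟨⟨y, hy, hyw⟩, hnI⟩, hn⟩ := (((hnear r hr).and (hlim.eventually hI)).and
      (ha.eventually_notMem hNk (hGL.mono_left hNG))).exists
    exact hn (subset_closure (hNI _ (hz n) hnI ⟨y, hy, hball hyw⟩ (hS.mem_levelCurve (hz n))))
  refine union_subset hGD (sUnion_subset ?_)
  rintro H ⟨⟨x₀, hx₀, rfl⟩, hHb⟩ x hx
  by_contra hxD
  have hGc : IsClosed Gᶜ := hS.isOpen.isClosed_compl
  -- A bounded neighbourhood of the hole has its frontier in `G`, so some curve surrounds this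
  -- frontier. A point of the hole outside that curve would confine the outer face to the bounded
  -- set `N`.
  obtain ⟨N, hN, hHN, hNk, -, hfr⟩ := exists_isolating_nhds hGc hx₀
    (Metric.isCompact_of_isClosed_isBounded (isClosed_connectedComponentIn_of_isClosed hGc _) hHb)
    isOpen_univ (subset_univ _)
  have hfrD : frontier N ⊆ D := fun w hw => hGD (not_not.1 (Set.disjoint_left.1 hfr hw))
  obtain ⟨n, hn⟩ := (hS.eventually_subset_enclosed hz hout
    (hNk.of_isClosed_subset isClosed_frontier frontier_subset_closure) hfrD).exists
  have hMb := (hS.isCompact_levelCurve (hz n)).isBounded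
  have hxo : x ∈ outerFace (levelCurve f U (z n)) := by
    by_contra h; exact hxD (mem_iUnion.2 ⟨n, h⟩)
  have hsub : outerFace (levelCurve f U (z n)) ⊆ N := by
    refine (isPreconnected_outerFace hMb).subset_of_disjoint_frontier ⟨x, hxo, hHN hx⟩ ?_
    rw [Set.disjoint_left]
    intro w hw hwf
    exact (hn hwf).1 hw
  exact not_isBounded_outerFace hMb (hNk.isBounded.subset (hsub.trans subset_closure))

end Increasing

/-! ### Curves decreasing towards `L` -/

section Decreasing

/-- The tail of the sequence lies in the compact set `filled (levelCurve f U (z m))`, so `L` must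
meet it. -/
theorem curve_subset_enclosed (hS : LevelCurveSetting f U G)
    (hL : IsLevelCurveIn f U G L ∨ IsComponentOf (frontier G) L)
    (hη : ∀ w ∈ L, extMod f w = η) (hz : ∀ n, z n ∈ G) (hzL : ∀ n, z n ∉ L) (ha : Approaches z L)
    (hin : ∀ m, ∀ᶠ n in atTop,
      filled (levelCurve f U (z n)) ⊆ enclosed (levelCurve f U (z m))) (m : ℕ) :
    L ⊆ enclosed (levelCurve f U (z m)) := by
  have hMk := hS.isCompact_levelCurve (hz m)
  have hmem : ∀ᶠ n in atTop, z n ∈ filled (levelCurve f U (z m)) := (hin m).mono fun n hn =>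
    enclosed_subset_filled (hn (subset_filled (hS.mem_levelCurve (hz n))))
  have hne : (L ∩ filled (levelCurve f U (z m))).Nonempty := by
    by_contra h
    obtain ⟨n, hn, hn'⟩ := (hmem.and (ha.eventually_notMem (isCompact_filled hMk)
      (disjoint_comm.1 (disjoint_iff_inter_eq_empty.2 (not_nonempty_iff_eq_empty.1 h))))).exists
    exact hn' hn
  exact (isConnected_of_curve hL).isPreconnected.subset_enclosed
    (hS.disjoint_levelCurve_curve hL hη (hz m) (hzL m)).subset_compl_left hne

/-- Level curves decreasing towards `L` exhaust the unbounded face of `L`. -/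
theorem iUnion_outerFace_eq (hS : LevelCurveSetting f U G)
    (hL : IsLevelCurveIn f U G L ∨ IsComponentOf (frontier G) L)
    (hη : ∀ w ∈ L, extMod f w = η) (hz : ∀ n, z n ∈ G) (hzL : ∀ n, z n ∉ L) (ha : Approaches z L)
    (hin : ∀ m, ∀ᶠ n in atTop,
      filled (levelCurve f U (z n)) ⊆ enclosed (levelCurve f U (z m)))
    (hb : Bornology.IsBounded L) :
    (⋃ n, outerFace (levelCurve f U (z n))) = connectedComponentIn Lᶜ (z 0) := by
  set E := ⋃ n, outerFace (levelCurve f U (z n)) with hE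
  have hEo : IsOpen E := isOpen_iUnion fun n =>
    isOpen_outerFace (hS.isCompact_levelCurve (hz n)).isClosed
  have hmono : ∀ m, ∀ᶠ n in atTop,
      outerFace (levelCurve f U (z m)) ⊆ outerFace (levelCurve f U (z n)) := fun m =>
    (hin m).mono fun n hn => compl_subset_compl.1 (hn.trans enclosed_subset_filled)
  have hEL : E ⊆ Lᶜ := iUnion_subset fun n x hx hxL =>
    (hS.curve_subset_enclosed hL hη hz hzL ha hin n hxL).1 hx
  have hEc : IsPreconnected E := by
    refine isPreconnected_of_forall_pair fun x hx y hy => ?_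
    obtain ⟨m, hm⟩ := mem_iUnion.1 hx
    obtain ⟨k, hk⟩ := mem_iUnion.1 hy
    obtain ⟨n, hn, hn'⟩ := ((hmono m).and (hmono k)).exists
    exact ⟨_, subset_iUnion_of_subset n Subset.rfl, hn hm, hn' hk,
      isPreconnected_outerFace (hS.isCompact_levelCurve (hz n)).isBounded⟩
  have hz0 : z 0 ∈ E := by
    obtain ⟨n, hn⟩ := (hin 0).exists
    refine mem_iUnion.2 ⟨n, ?_⟩
    by_contra h
    exact (hn h).2 (hS.mem_levelCurve (hz 0))
  refine Subset.antisymm (hEc.subset_connectedComponentIn hz0 hEL) ?_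
  refine isPreconnected_connectedComponentIn.subset_of_disjoint_frontier
    ⟨z 0, mem_connectedComponentIn (hzL 0), hz0⟩ ?_
  rw [Set.disjoint_left]
  intro w hw hwf
  refine connectedComponentIn_subset _ _ hw (hS.mem_of_eventually_inter_ball_nonempty hL hη hz ha
    hb fun r hr => ?_)
  rw [hEo.frontier_eq] at hwf
  obtain ⟨y, hy, hyE⟩ := mem_closure_iff.1 hwf.1 _ Metric.isOpen_ball (Metric.mem_ball_self hr)
  obtain ⟨m, hm⟩ := mem_iUnion.1 hyE
  filter_upwards [hmono m] with n hn
  by_contra hcon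
  have h1 : Metric.ball w r ⊆ outerFace (levelCurve f U (z n)) :=
    Metric.isPreconnected_ball.subset_outerFace (fun x hx hxM => hcon ⟨x, hxM, hx⟩)
      ⟨y, hy, hn hm⟩
  exact hwf.2 (mem_iUnion.2 ⟨n, h1 (Metric.mem_ball_self hr)⟩)

/-- No boundedness of `K` is needed: the part of `K` beyond the curve of `z 0` is already outside,
and the remaining part is compact. -/
theorem eventually_subset_outerFace (hS : LevelCurveSetting f U G) (hz : ∀ n, z n ∈ G)
    (hin : ∀ m, ∀ᶠ n in atTop,
      filled (levelCurve f U (z n)) ⊆ enclosed (levelCurve f U (z m))) {K : Set ℂ}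
    (hK : IsClosed K) (hKE : K ⊆ ⋃ n, outerFace (levelCurve f U (z n))) :
    ∀ᶠ n in atTop, K ⊆ outerFace (levelCurve f U (z n)) := by
  have hmono : ∀ m, ∀ᶠ n in atTop,
      outerFace (levelCurve f U (z m)) ⊆ outerFace (levelCurve f U (z n)) := fun m =>
    (hin m).mono fun n hn => compl_subset_compl.1 (hn.trans enclosed_subset_filled)
  have hKk : IsCompact (K ∩ filled (levelCurve f U (z 0))) :=
    (isCompact_filled (hS.isCompact_levelCurve (hz 0))).inter_left hK
  have h1 : ∀ᶠ n in atTop, K ∩ filled (levelCurve f U (z 0)) ⊆ outerFace (levelCurve f U (z n))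
      := by
    refine hKk.induction_on (p := fun K => ∀ᶠ n in atTop, K ⊆ outerFace (levelCurve f U (z n)))
      (Eventually.of_forall fun _ => empty_subset _) ?_ ?_ ?_
    · intro s t hst ht; exact ht.mono fun n hn => hst.trans hn
    · intro s t hs ht; exact (hs.and ht).mono fun n hn => union_subset hn.1 hn.2
    · intro x hx
      obtain ⟨m, hm⟩ := mem_iUnion.1 (hKE hx.1)
      exact ⟨_, mem_nhdsWithin_of_mem_nhds
        ((isOpen_outerFace (hS.isCompact_levelCurve (hz m)).isClosed).mem_nhds hm), hmono m⟩
  filter_upwards [h1, hmono 0] with n hn hn' x hx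
  by_cases hx0 : x ∈ filled (levelCurve f U (z 0))
  · exact hn ⟨hx, hx0⟩
  · exact hn' (not_not.1 hx0)

end Decreasing

end Sequence

end LevelCurveSetting

/-! ### Separation and conclusion -/

/-- The level curve of `z` is non-critical, and it separates `K` from `L`. -/
def Separates (f : ℂ → ℂ) (U G L : Set ℂ) (η : ℝ≥0∞) (K C : Set ℂ) (z : ℂ) : Prop :=
  extMod f z ≠ η ∧
  (IsLevelCurveIn f U G (levelCurve f U z) ∧ ¬ IsCriticalCurve f (levelCurve f U z)) ∧
  (∃ F₁ F₂, IsFace (levelCurve f U z) F₁ ∧ IsFace (levelCurve f U z) F₂ ∧ F₁ ≠ F₂ ∧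
    K ⊆ F₁ ∧ L ⊆ F₂) ∧
  ((Bornology.IsBounded L ∧ ¬ Bornology.IsBounded C) →
    ∃ F, IsFace (levelCurve f U z) F ∧ ¬ Bornology.IsBounded F ∧ K ⊆ F) ∧
  (¬ (Bornology.IsBounded L ∧ ¬ Bornology.IsBounded C) →
    ∃ F, IsFace (levelCurve f U z) F ∧ Bornology.IsBounded F ∧
      (∀ F', IsFace (levelCurve f U z) F' → Bornology.IsBounded F' → F' = F) ∧ K ⊆ F)

namespace LevelCurveSetting

variable {f : ℂ → ℂ} {U G L K C : Set ℂ} {η : ℝ≥0∞}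

/-- The inner curve forces a single bounded face of `Λ_z`; together with the outer curve it rules
out critical points. -/
theorem separates_of_nested (hS : LevelCurveSetting f U G) {z₁ z z₂ : ℂ}
    (hz₁ : z₁ ∈ regularSet f G) (hz : z ∈ regularSet f G) (hz₂ : z₂ ∈ regularSet f G)
    (h₁ : enclosedObstacles f G (levelCurve f U z₁) = enclosedObstacles f G (levelCurve f U z))
    (h₂ : enclosedObstacles f G (levelCurve f U z) = enclosedObstacles f G (levelCurve f U z₂))
    (hs₁ : filled (levelCurve f U z₁) ⊆ enclosed (levelCurve f U z))
    (hs₂ : filled (levelCurve f U z) ⊆ enclosed (levelCurve f U z₂))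
    (hne : extMod f z ≠ η)
    (h : (K ⊆ enclosed (levelCurve f U z) ∧ L ⊆ outerFace (levelCurve f U z) ∧
          ¬ (Bornology.IsBounded L ∧ ¬ Bornology.IsBounded C)) ∨
        (K ⊆ outerFace (levelCurve f U z) ∧ L ⊆ enclosed (levelCurve f U z) ∧
          Bornology.IsBounded L ∧ ¬ Bornology.IsBounded C)) :
    Separates f U G L η K C z := by
  have hMb := (hS.isCompact_levelCurve hz.1).isBounded
  have hVb : Bornology.IsBounded (enclosed (levelCurve f U z)) :=
    (isBounded_filled hMb).subset enclosed_subset_filled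
  have hVo : enclosed (levelCurve f U z) ≠ outerFace (levelCurve f U z) := fun he =>
    not_isBounded_outerFace hMb (he ▸ hVb)
  obtain ⟨x, hx⟩ := hS.enclosed_nonempty hz
  have hV : IsFace (levelCurve f U z) (enclosed (levelCurve f U z)) :=
    ⟨x, hx.2, (hS.connectedComponentIn_eq_enclosed hz hz₁ h₁ hs₁ hx).symm⟩
  refine ⟨hne, ⟨hS.isLevelCurveIn_levelCurve hz.1, fun ⟨_, c, hc, hcc⟩ =>
    hS.not_isCriticalPt_of_nested hz₁ hz hz₂ h₁ h₂ hs₁ hs₂ hc hcc⟩, ?_, ?_, ?_⟩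
  · rcases h with ⟨hK, hL, -⟩ | ⟨hK, hL, -⟩
    · exact ⟨_, _, hV, isFace_outerFace hMb, hVo, hK, hL⟩
    · exact ⟨_, _, isFace_outerFace hMb, hV, hVo.symm, hK, hL⟩
  · intro hb
    rcases h with ⟨-, -, h⟩ | ⟨hK, -⟩
    · exact absurd hb h
    · exact ⟨_, isFace_outerFace hMb, not_isBounded_outerFace hMb, hK⟩
  · intro hb
    rcases h with ⟨hK, -⟩ | ⟨-, -, h⟩
    · refine ⟨_, hV, hVb, ?_, hK⟩
      rintro F' ⟨y, hy, rfl⟩ hyb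
      exact hS.connectedComponentIn_eq_enclosed hz hz₁ h₁ hs₁ (mem_enclosed.2 ⟨hy, hyb⟩)
    · exact absurd h hb

/-- A sequence approaching `L` has a subsequence of regular points whose level curves are nested
and surround the same obstacles. -/
theorem exists_nested_subseq (hS : LevelCurveSetting f U G)
    (hL : IsLevelCurveIn f U G L ∨ IsComponentOf (frontier G) L)
    (hη : ∀ w ∈ L, extMod f w = η) {z : ℕ → ℂ} (hz : ∀ n, z n ∈ G) (hzL : ∀ n, z n ∉ L)
    (ha : Approaches z L) :
    ∃ φ : ℕ → ℕ, StrictMono φ ∧ (∀ n, z (φ n) ∈ regularSet f G) ∧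
      (∀ n, extMod f (z (φ n)) ≠ η) ∧
      (∀ m n, enclosedObstacles f G (levelCurve f U (z (φ m))) =
        enclosedObstacles f G (levelCurve f U (z (φ n)))) ∧
      ((∀ m, ∀ᶠ n in atTop,
          filled (levelCurve f U (z (φ m))) ⊆ enclosed (levelCurve f U (z (φ n)))) ∨
        ∀ m, ∀ᶠ n in atTop,
          filled (levelCurve f U (z (φ n))) ⊆ enclosed (levelCurve f U (z (φ m)))) := by
  obtain ⟨S, hfreq⟩ := frequently_and_eq_of_finite hS.finite_obstacles.finite_subsets
    (g := fun n => enclosedObstacles f G (levelCurve f U (z n))) (fun n o ho => ho.1)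
    ((hS.eventually_mem_regularSet hz hzL ha).and
      (hS.eventually_extMod_ne hL hη hz hzL ha)).frequently
  obtain ⟨φ, hφ, hφP⟩ := extraction_of_frequently_atTop hfreq
  let r : ℂ → ℂ → Prop := fun x y => filled (levelCurve f U x) ⊆ enclosed (levelCurve f U y)
  have : IsTrans ℂ r := ⟨fun a b c hab hbc => hab.trans (enclosed_subset_filled.trans hbc)⟩
  -- Ramsey's theorem yields a chain or a subsequence without any forward nesting. In the second
  -- case nesting is reversed as soon as the moduli differ, and eventually they do because they tend
  -- to `η ≠ |f (z m)|`.
  obtain ⟨g, hg⟩ := exists_increasing_or_nonincreasing_subseq r (z ∘ φ)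
  have hg' : StrictMono (φ ∘ g) := hφ.comp g.strictMono
  refine ⟨φ ∘ g, hg', fun n => (hφP (g n)).1.1, fun n => (hφP (g n)).1.2,
    fun m n => (hφP (g m)).2.trans (hφP (g n)).2.symm, hg.imp ?_ ?_⟩
  · exact fun h m => (eventually_gt_atTop m).mono fun n hn => h m n hn
  · intro h m
    have hlim := (hS.tendsto_extMod hL hη hz ha).comp hg'.tendsto_atTop
    filter_upwards [eventually_gt_atTop m,
      hlim.eventually_ne (hφP (g m)).1.2.symm] with n hn hne
    exact (hS.nested_of_ne (hφP (g n)).1.1 (hφP (g m)).1.1 hne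
      ((hφP (g m)).2.trans (hφP (g n)).2.symm)).resolve_left (h m n hn)

end LevelCurveSetting

theorem mainTheorem9 (f : ℂ → ℂ) (U G : Set ℂ) (hS : LevelCurveSetting f U G)
    (L : Set ℂ) (hL : IsLevelCurveIn f U G L ∨ IsComponentOf (frontier G) L)
    (η : ℝ≥0∞) (hη : ∀ w ∈ L, extMod f w = η)
    (K C : Set ℂ) (hC : IsComponentOf Lᶜ C)
    (hK : IsClosed K) (hKG : K ⊆ sc G) (hKC : K ⊆ C)
    (hbdd : Bornology.IsBounded L ∨ Bornology.IsBounded K) :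
    ∃ δ : ℝ, 0 < δ ∧ ∀ z ∈ G, z ∈ C → Metric.infDist z L < δ →
      extMod f z ≠ η ∧
      (IsLevelCurveIn f U G (levelCurve f U z) ∧ ¬ IsCriticalCurve f (levelCurve f U z)) ∧
      (∃ F₁ F₂, IsFace (levelCurve f U z) F₁ ∧ IsFace (levelCurve f U z) F₂ ∧ F₁ ≠ F₂ ∧
        K ⊆ F₁ ∧ L ⊆ F₂) ∧
      ((Bornology.IsBounded L ∧ ¬ Bornology.IsBounded C) →
        ∃ F, IsFace (levelCurve f U z) F ∧ ¬ Bornology.IsBounded F ∧ K ⊆ F) ∧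
      (¬ (Bornology.IsBounded L ∧ ¬ Bornology.IsBounded C) →
        ∃ F, IsFace (levelCurve f U z) F ∧ Bornology.IsBounded F ∧
          (∀ F', IsFace (levelCurve f U z) F' → Bornology.IsBounded F' → F' = F) ∧ K ⊆ F) := by
  have hLc := hS.isClosed_curve hL hη
  by_contra hcon
  have hseq : ∀ n : ℕ, ∃ z ∈ G, z ∈ C ∧ Metric.infDist z L < 1 / ((n : ℝ) + 1) ∧
      ¬ Separates f U G L η K C z := by
    intro n
    by_contra hn
    push Not at hn
    exact hcon ⟨1 / ((n : ℝ) + 1), by positivity, hn⟩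
  choose z₀ hz₀ hz₀C hz₀d hz₀s using hseq
  obtain ⟨x, hx, rfl⟩ := hC
  obtain ⟨φ, hφ, ha₀⟩ := exists_subseq_approaches hLc
    (LevelCurveSetting.isConnected_of_curve hL).nonempty hz₀d
  obtain ⟨ψ, hψ, hreg, hne, hobs, hnest⟩ := hS.exists_nested_subseq hL hη
    (fun n => hz₀ (φ n)) (fun n => connectedComponentIn_subset _ _ (hz₀C (φ n))) ha₀
  have ha := ha₀.comp hψ
  set z : ℕ → ℂ := (z₀ ∘ φ) ∘ ψ with hzdef
  have hz : ∀ n, z n ∈ G := fun n => hz₀ _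
  have hzL : ∀ n, z n ∉ L := fun n => connectedComponentIn_subset _ _ (hz₀C _)
  have hns : ∀ n, ¬ Separates f U G L η K (connectedComponentIn Lᶜ x) (z n) := fun n => hz₀s _
  have hCz : connectedComponentIn Lᶜ x = connectedComponentIn Lᶜ (z 0) :=
    connectedComponentIn_eq (hz₀C _)
  rw [hCz] at hns hKC
  rcases hnest with hout | hin
  -- This is where boundedness of `L` or `K` enters: a bounded `L` places `K` in a bounded face, and
  -- otherwise `K` is bounded and lies in the exhausted set `sc G`.
  · have hKD : IsCompact K ∧ K ⊆ ⋃ n, filled (levelCurve f U (z n)) := by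
      by_cases hLb : Bornology.IsBounded L
      · obtain ⟨hD, hDb⟩ := hS.iUnion_filled_eq hL hη hz hzL ha hout hLb
        rw [← hD] at hKC
        exact ⟨Metric.isCompact_of_isClosed_isBounded hK (hDb.subset hKC), hKC⟩
      · exact ⟨Metric.isCompact_of_isClosed_isBounded hK (hbdd.resolve_left hLb),
          hKG.trans (hS.sc_subset_iUnion_filled hL hη hz ha hout hLb)⟩
    obtain ⟨n, hn, hKn⟩ :=
      ((hout 0).and (hS.eventually_subset_enclosed hz hout hKD.1 hKD.2)).exists
    obtain ⟨k, hk⟩ := (hout n).exists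
    refine hns n (hS.separates_of_nested (hreg 0) (hreg n) (hreg k) (hobs 0 n) (hobs n k) hn hk
      (hne n) (Or.inl ⟨hKn, hS.curve_subset_outerFace hL hη hz hzL ha hout n, ?_⟩))
    -- Increasing curves fill `C` by a bounded union, so the alternative with an unbounded `C` does
    -- not arise here.
    rintro ⟨hLb, hCb⟩
    obtain ⟨hD, hDb⟩ := hS.iUnion_filled_eq hL hη hz hzL ha hout hLb
    exact hCb (hD ▸ hDb)
  · have hLn := hS.curve_subset_enclosed hL hη hz hzL ha hin
    have hLb : Bornology.IsBounded L :=
      (isBounded_filled (hS.isCompact_levelCurve (hz 0)).isBounded).subset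
        ((hLn 0).trans enclosed_subset_filled)
    have hE := hS.iUnion_outerFace_eq hL hη hz hzL ha hin hLb
    obtain ⟨n, hn, hKn⟩ :=
      ((hin 0).and (hS.eventually_subset_outerFace hz hin hK (hE ▸ hKC))).exists
    obtain ⟨k, hk⟩ := (hin n).exists
    -- The roles are reversed: the later curve `k` is inside and the curve of `z 0` outside. The
    -- face `C` is unbounded because it contains an outer face.
    refine hns n (hS.separates_of_nested (hreg k) (hreg n) (hreg 0) (hobs k n) (hobs n 0) hk hn
      (hne n) (Or.inr ⟨hKn, hLn n, hLb, fun hCb => ?_⟩))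
    rw [← hE] at hCb
    exact not_isBounded_outerFace (hS.isCompact_levelCurve (hz 0)).isBounded
      (hCb.subset (subset_iUnion (fun n => outerFace (levelCurve f U (z n))) 0))
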